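/- Let $k$ be an algebraically closed field, let $n\ge 1$ be an integer that is invertible in $k$, and let $Y$ be a smooth surface over $k$. Let $M$ be a line bundle on $Y$, let $B$ be a smooth (reduced) effective divisor with $B\sim nM$, and let $\pi:X\to Y$ be the associated $n$-cyclic covering with branch divisor $B$, that is, the subscheme $t^n=s$ of the total space of $M$, where $s$ is a section of $M^{\otimes n}$ with divisor $B$ and $t$ is the tautological section. Let $P$ be a closed point of the ramification divisor $R=\pi^{-1}(B)_{\mathrm{red}}$ and put $Q=\pi(P)\in B$. Consider the cluster $(Q_1,\dots,Q_n)$ of infinitely near points along $B$ defined as follows. Put $Y_0=Y$, $B_0=B$, $Q_1=Q$. For $1\le i\le n-1$ let $Y_i$ be the blow-up of $Y_{i-1}$ at $Q_i$, let $E_i$ be its exceptional divisor, let $B_i$ be the strict transform of $B_{i-1}$, and let $Q_{i+1}=E_i\cap B_i$. Let $C$ be an effective divisor on $Y$ and let $m$ be the multiplicity of the ($\sigma$-invariant, where $\sigma$ is the automorphism of $X$ over $Y$ induced by the covering) divisor $D=\pi^*C$ at $P$. Put $C_0=C$, let $C_i\subset Y_i$ be the strict transform of $C_{i-1}$ for $1\le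 i\le n-1$, and let $m_i$ be the multiplicity of $C_{i-1}$ at $Q_i$ for $1\le i\le n$ (that is, $C$ passes through the cluster $(Q_1,\dots,Q_n)$ with multiplicities $(m_1,\dots,m_n)$; an $m_i$ may be $0$). Then $$m=\sum_{i=1}^n m_i .$$ -/

import Mathlib

open CategoryTheory AlgebraicGeometry

universe u

noncomputable section

namespace SurfaceCovering

/-- `f : Y ⟶ Spec k` is a smooth (irreducible) surface over `k`. -/
structure IsSmoothSurface {k : Type u} [Field k] {Y : Scheme.{u}}
    (f : Y ⟶ Spec (CommRingCat.of k)) : Prop where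
  integral : IsIntegral Y
  separated : IsSeparated f
  quasiCompact : QuasiCompact f
  smooth : SmoothOfRelativeDimension 2 f

/-- Closed subschemes are given by their ideal sheaves. The ideal sheaf `I` is the ideal sheaf of
an effective (Cartier) divisor if it is locally generated by one non-zero-divisor, a local equation
of the divisor. -/
def IsEffectiveDivisor {Y : Scheme.{u}} (I : Y.IdealSheafData) : Prop :=
  ∀ y : Y, ∃ U : Y.affineOpens, y ∈ U.1 ∧
    ∃ f ∈ nonZeroDivisors Γ(Y, U.1), I.ideal U = Ideal.span {f}

/-- The divisor with ideal sheaf `B` on the surface `f : Y ⟶ Spec k` is smooth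
(in particular reduced): as a scheme it is a smooth curve over `k`. -/
def IsSmoothDivisor {k : Type u} [Field k] {Y : Scheme.{u}}
    (f : Y ⟶ Spec (CommRingCat.of k)) (B : Y.IdealSheafData) : Prop :=
  IsEffectiveDivisor B ∧ SmoothOfRelativeDimension 1 (B.subschemeι ≫ f)

/-- The stalk at `y` of an ideal sheaf, as an ideal of the local ring of `Y` at `y`. -/
def stalkIdeal {Y : Scheme.{u}} (I : Y.IdealSheafData) (y : Y) : Ideal (Y.presheaf.stalk y) :=
  ⨆ (U : Y.affineOpens) (hy : y ∈ U.1), (I.ideal U).map (Y.presheaf.germ U.1 y hy).hom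

/-- The divisor with ideal sheaf `I` has multiplicity exactly `m` at the point `y`: its local
equation lies in the `m`-th but not in the `(m+1)`-st power of the maximal ideal at `y`. -/
def HasMultiplicity {Y : Scheme.{u}} (I : Y.IdealSheafData) (y : Y) (m : ℕ) : Prop :=
  stalkIdeal I y ≤ IsLocalRing.maximalIdeal (Y.presheaf.stalk y) ^ m ∧
    ¬ stalkIdeal I y ≤ IsLocalRing.maximalIdeal (Y.presheaf.stalk y) ^ (m + 1)

/-- `π : X ⟶ Y` is the `n`-cyclic covering defined by a line bundle `M` on `Y` and a section `s` of
`M ^ n` with divisor `B`. The line bundle is given by its cocycle `g` on an affine open covering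
`U`, the section `s` by its local expressions, and `X` is the subscheme `t ^ n = s` of the total
space of `M`, where `t` is the tautological section, i.e.
`π_* O_X = O_Y ⊕ O_Y t ⊕ ⋯ ⊕ O_Y t ^ (n - 1)` locally. -/
structure CyclicCoveringData {X Y : Scheme.{u}} (π : X ⟶ Y) (n : ℕ) (B : Y.IdealSheafData) where
  ι : Type u
  U : ι → Y.affineOpens
  covers : ∀ y : Y, ∃ i, y ∈ (U i).1
  g : ∀ i j, Γ(Y, (U i).1 ⊓ (U j).1)ˣ
  cocycle : ∀ i j l,
    Y.presheaf.map (homOfLE (show (U i).1 ⊓ (U j).1 ⊓ (U l).1 ≤ (U i).1 ⊓ (U j).1 from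
        inf_le_left)).op (g i j).1 *
      Y.presheaf.map (homOfLE (show (U i).1 ⊓ (U j).1 ⊓ (U l).1 ≤ (U j).1 ⊓ (U l).1 from
        inf_le_inf_right _ inf_le_right)).op (g j l).1 =
      Y.presheaf.map (homOfLE (show (U i).1 ⊓ (U j).1 ⊓ (U l).1 ≤ (U i).1 ⊓ (U l).1 from
        inf_le_inf_right _ inf_le_left)).op (g i l).1
  s : ∀ i, Γ(Y, (U i).1)
  s_glue : ∀ i j,
    Y.presheaf.map (homOfLE (show (U i).1 ⊓ (U j).1 ≤ (U i).1 from inf_le_left)).op (s i) =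
      (g i j).1 ^ n *
        Y.presheaf.map (homOfLE (show (U i).1 ⊓ (U j).1 ≤ (U j).1 from inf_le_right)).op (s j)
  ideal_eq : ∀ i, B.ideal (U i) = Ideal.span {s i}
  affine : IsAffineHom π
  t : ∀ i, Γ(X, π ⁻¹ᵁ (U i).1)
  t_glue : ∀ i j,
    X.presheaf.map (homOfLE (show π ⁻¹ᵁ ((U i).1 ⊓ (U j).1) ≤ π ⁻¹ᵁ (U i).1 from
        π.preimage_mono inf_le_left)).op (t i) =
      π.app ((U i).1 ⊓ (U j).1) (g i j).1 *
        X.presheaf.map (homOfLE (show π ⁻¹ᵁ ((U i).1 ⊓ (U j).1) ≤ π ⁻¹ᵁ (U j).1 from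
          π.preimage_mono inf_le_right)).op (t j)
  t_pow : ∀ i, t i ^ n = π.app (U i).1 (s i)
  basis : ∀ i, ∀ a : Γ(X, π ⁻¹ᵁ (U i).1), ∃! c : Fin n → Γ(Y, (U i).1),
    a = ∑ l : Fin n, π.app (U i).1 (c l) * t i ^ (l : ℕ)

/-- `π : X ⟶ Y` is an `n`-cyclic covering with branch divisor `B`. -/
def IsCyclicCovering {X Y : Scheme.{u}} (π : X ⟶ Y) (n : ℕ) (B : Y.IdealSheafData) : Prop :=
  Nonempty (CyclicCoveringData π n B)

/-- The ramification divisor: the reduced preimage of the branch divisor `B`. -/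
def ramification {X Y : Scheme.{u}} (π : X ⟶ Y) (B : Y.IdealSheafData) : X.IdealSheafData :=
  (B.comap π).radical

/-- The ideal sheaf of (the closure of) the point `Q`, with its reduced structure. -/
def pointIdeal {Y : Scheme.{u}} (Q : Y) : Y.IdealSheafData :=
  Scheme.IdealSheafData.vanishingIdeal (TopologicalSpace.Closeds.closure {Q})

/-- `b : Y' ⟶ Y` is the blow-up of `Y` along the ideal sheaf `J`: the inverse image of `J` is
invertible, and `b` is universal with this property. -/
def IsBlowUp {Y' Y : Scheme.{u}} (b : Y' ⟶ Y) (J : Y.IdealSheafData) : Prop :=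
  IsEffectiveDivisor (J.comap b) ∧
    ∀ (W : Scheme.{u}) (h : W ⟶ Y), IsEffectiveDivisor (J.comap h) → ∃! l : W ⟶ Y', l ≫ b = h

/-- The exceptional divisor of the blow-up `b` of the point `Q`. -/
def exceptional {Y' Y : Scheme.{u}} (b : Y' ⟶ Y) (Q : Y) : Y'.IdealSheafData :=
  (pointIdeal Q).comap b

/-- The strict transform of a closed subscheme `I` under the blow-up `b` of the point `Q`: the
scheme-theoretic closure in `Y'` of the part of the total transform `b⁻¹(I)` that lies outside the
exceptional divisor. -/
def strictTransform {Y' Y : Scheme.{u}} (b : Y' ⟶ Y) (Q : Y) (I : Y.IdealSheafData) :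
    Y'.IdealSheafData :=
  (((I.comap b).subschemeι ⁻¹ᵁ (exceptional b Q).support.compl).ι ≫ (I.comap b).subschemeι).ker

/-- The successive strict transforms of `I` in a sequence of blow-ups
`⋯ ⟶ Y 2 ⟶ Y 1 ⟶ Y 0` with centres `Q 0, Q 1, …`. -/
def iteratedStrictTransform {Y : ℕ → Scheme.{u}} (b : ∀ i, Y (i + 1) ⟶ Y i) (Q : ∀ i, Y i)
    (I : (Y 0).IdealSheafData) : ∀ i, (Y i).IdealSheafData
  | 0 => I
  | i + 1 => strictTransform (b i) (Q i) (iteratedStrictTransform b Q I i)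

/-- `Q 0, …, Q (n - 1)` is the cluster of `n` infinitely near points along the divisor `B` of `Y 0`
starting at `Q 0`: each `Y (i + 1)` is the blow-up of `Y i` at `Q i`, and `Q (i + 1)` is the point
where the exceptional divisor of this blow-up meets the strict transform of `B`. Only the surfaces
`Y i` and the points `Q i` with `i < n` matter; the others are arbitrary. -/
structure IsClusterAlong (n : ℕ) {Y : ℕ → Scheme.{u}} (b : ∀ i, Y (i + 1) ⟶ Y i) (Q : ∀ i, Y i)
    (B : (Y 0).IdealSheafData) : Prop where
  closed : ∀ i, i < n → IsClosed ({Q i} : Set (Y i))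
  blowUp : ∀ i, i + 1 < n → IsBlowUp (b i) (pointIdeal (Q i))
  mem_exceptional : ∀ i, i + 1 < n → Q (i + 1) ∈ (exceptional (b i) (Q i)).support
  mem_branch : ∀ i, i + 1 < n → Q (i + 1) ∈ (iteratedStrictTransform b Q B (i + 1)).support

end SurfaceCovering

end

/-! Let `s` be a local equation of B at Q and let `y` restrict to a uniformizer of B, so that `(s,
y)` are parameters at Q. Give `s` weight n and `y` weight 1; `weightedIdeal s y n k` collects the
elements of weighted order at least k. The weighted order of a local equation f of C is computed in
two ways.

On the covering, t ^ n = s and `(t, y)` are parameters at P (`IsCyclicAlgebra.isParameterPair`).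
With t and y both of weight 1, the ordinary order of the pullback of f equals the weighted order of
f (`IsParameterPair.weightedIdeal_of_pow`), so this order is m.

Under a blow-up, at the next point of the cluster, s = y s' with s' an equation of the strict
transform of B; as y has weight 1, s' gets weight n - 1. Writing f = y ^ μ g, with μ the
multiplicity of C and g an equation of its strict transform, the weighted order of f is μ plus that
of g for the weights (n - 1, 1) (`IsParameterPair.exists_strictTransform`). After n - 1 blow-ups the
weights are (1, 1) and the remaining order is the last multiplicity
(`IsClusterAlong.exists_sum_eq`).

Both computations rest on one fact: a local homomorphism taking parameters to monomials in
parameters, with matching weights, preserves the weighted order (`map_mem_weightedIdeal`,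
`IsParameterPair.mem_weightedIdeal_succ`). The blow-up is given only by its universal property, so
`IsBlowUp.isParameterPair` first identifies its local ring with a localization of A[s / y]. -/

namespace SurfaceCovering

/-! ### Weighted order with respect to a pair of parameters. -/

section Weighted

variable {A A' : Type*} [CommRing A] [CommRing A']

/-- The ideal generated by the monomials `s ^ i * y ^ j` of weight at least `k`, where `s` has
weight `n` and `y` has weight `1`. -/
def weightedIdeal (s y : A) (n k : ℕ) : Ideal A :=
  Ideal.span {x | ∃ i j, k ≤ n * i + j ∧ x = s ^ i * y ^ j}

/-- A pair of generators of the maximal ideal of a local ring forming a regular sequence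
(in any order). -/
structure IsParameterPair [IsLocalRing A] (s y : A) : Prop where
  span_eq : IsLocalRing.maximalIdeal A = Ideal.span {s, y}
  left_mem : s ∈ nonZeroDivisors A
  right_mem : y ∈ nonZeroDivisors A
  dvd : ∀ a, s ∣ y * a → s ∣ a

lemma monomial_mem_weightedIdeal (s y : A) {n k i j : ℕ} (h : k ≤ n * i + j) :
    s ^ i * y ^ j ∈ weightedIdeal s y n k :=
  Ideal.subset_span ⟨i, j, h, rfl⟩

lemma weightedIdeal_zero (s y : A) (n : ℕ) : weightedIdeal s y n 0 = ⊤ := by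
  rw [Ideal.eq_top_iff_one]
  simpa using monomial_mem_weightedIdeal s y (n := n) (k := 0) (i := 0) (j := 0) (by simp)

lemma weightedIdeal_antitone (s y : A) (n : ℕ) : Antitone (weightedIdeal s y n) := by
  intro k l h
  refine Ideal.span_mono ?_
  rintro x ⟨i, j, hij, rfl⟩
  exact ⟨i, j, h.trans hij, rfl⟩

lemma left_mul_mem_weightedIdeal {s y u : A} {n k : ℕ} (hu : u ∈ weightedIdeal s y n k) :
    s * u ∈ weightedIdeal s y n (k + n) := by
  have : weightedIdeal s y n k ≤ Submodule.comap (LinearMap.mulLeft A s) (weightedIdeal s y n (k + n)) := by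
    refine Ideal.span_le.2 ?_
    rintro _ ⟨i, j, hij, rfl⟩
    have := monomial_mem_weightedIdeal s y (n := n) (k := k + n) (i := i + 1) (j := j)
      (by rw [mul_add]; omega)
    simpa [pow_succ', mul_assoc] using this
  exact this hu

lemma right_mul_mem_weightedIdeal {s y u : A} {n k : ℕ} (hu : u ∈ weightedIdeal s y n k) :
    y * u ∈ weightedIdeal s y n (k + 1) := by
  have : weightedIdeal s y n k ≤
      Submodule.comap (LinearMap.mulLeft A y) (weightedIdeal s y n (k + 1)) := by
    refine Ideal.span_le.2 ?_
    rintro _ ⟨i, j, hij, rfl⟩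
    have := monomial_mem_weightedIdeal s y (n := n) (k := k + 1) (i := i) (j := j + 1) (by omega)
    simpa [pow_succ', mul_left_comm] using this
  exact this hu

lemma right_pow_mul_mem_weightedIdeal {s y u : A} {n k : ℕ} (hu : u ∈ weightedIdeal s y n k)
    (l : ℕ) : y ^ l * u ∈ weightedIdeal s y n (k + l) := by
  induction l with
  | zero => simpa using hu
  | succ l ih =>
    have := right_mul_mem_weightedIdeal ih
    rwa [← mul_assoc, ← pow_succ'] at this

/-- Monomials free of `s` are multiples of `y ^ k`; the others give up one factor `s` of weight `n`.
This splitting drives the inductions on the weight. By truncated subtraction the condition on `u` is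
void when `k ≤ n`. -/
lemma mem_weightedIdeal_iff {s y x : A} {n k : ℕ} :
    x ∈ weightedIdeal s y n k ↔
      ∃ c, ∃ u ∈ weightedIdeal s y n (k - n), x = c * y ^ k + s * u := by
  constructor
  · intro hx
    have : weightedIdeal s y n k ≤
        Ideal.span {y ^ k} ⊔ Submodule.map (LinearMap.mulLeft A s) (weightedIdeal s y n (k - n)) := by
      refine Ideal.span_le.2 ?_
      rintro _ ⟨i, j, hij, rfl⟩
      rcases i with _ | i
      · refine Ideal.mem_sup_left (Ideal.mem_span_singleton.2 ?_)
        simpa using pow_dvd_pow y (by simpa using hij)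
      · refine Ideal.mem_sup_right ⟨s ^ i * y ^ j, monomial_mem_weightedIdeal s y ?_, ?_⟩
        · rw [mul_add] at hij; omega
        · simp [pow_succ', mul_assoc]
    obtain ⟨a, ha, b, ⟨u, hu, rfl⟩, rfl⟩ := Submodule.mem_sup.1 (this hx)
    obtain ⟨c, rfl⟩ := Ideal.mem_span_singleton'.1 ha
    exact ⟨c, u, hu, rfl⟩
  · rintro ⟨c, u, hu, rfl⟩
    refine add_mem (Ideal.mul_mem_left _ _ ?_)
      (weightedIdeal_antitone s y n (by omega) (left_mul_mem_weightedIdeal hu))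
    simpa using monomial_mem_weightedIdeal s y (n := n) (k := k) (i := 0) (j := k) (by simp)

lemma weightedIdeal_one (s y : A) (k : ℕ) :
    weightedIdeal s y 1 k = Ideal.span {s, y} ^ k := by
  apply le_antisymm
  · refine Ideal.span_le.2 ?_
    rintro _ ⟨i, j, hij, rfl⟩
    refine Ideal.pow_le_pow_right (show k ≤ i + j by omega) ?_
    rw [pow_add]
    exact Ideal.mul_mem_mul (Ideal.pow_mem_pow (Ideal.subset_span (by simp)) _)
      (Ideal.pow_mem_pow (Ideal.subset_span (by simp)) _)
  · induction k with
    | zero => simp [weightedIdeal_zero]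
    | succ k ih =>
      rw [pow_succ', Ideal.mul_le]
      intro r hr x hx
      obtain ⟨a, b, rfl⟩ := Ideal.mem_span_pair.1 hr
      have h1 := left_mul_mem_weightedIdeal (ih hx)
      have h2 := right_mul_mem_weightedIdeal (ih hx)
      rw [add_mul, mul_assoc, mul_assoc]
      exact add_mem (Ideal.mul_mem_left _ _ h1) (Ideal.mul_mem_left _ _ h2)

lemma weightedIdeal_one_le {n : ℕ} (hn : 1 ≤ n) (s y : A) (k : ℕ) :
    weightedIdeal s y 1 k ≤ weightedIdeal s y n k := by
  refine Ideal.span_mono ?_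
  rintro x ⟨i, j, hij, rfl⟩
  exact ⟨i, j, hij.trans (by gcongr), rfl⟩

/-- The equation `n = b + a * n'` says that `y' ^ b * s' ^ a` again has weight `n`. The two cases
needed are `a = b = 1` (blow-up) and `b = 0`, `n' = 1` (covering). -/
lemma map_mem_weightedIdeal (φ : A →+* A') {s y : A} {s' y' : A'} {a b n n' : ℕ}
    (hs : φ s = y' ^ b * s' ^ a) (hy : φ y = y') (hn : n = b + a * n') {k : ℕ} {x : A}
    (hx : x ∈ weightedIdeal s y n k) : φ x ∈ weightedIdeal s' y' n' k := by
  suffices weightedIdeal s y n k ≤ (weightedIdeal s' y' n' k).comap φ from this hx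
  refine Ideal.span_le.2 ?_
  rintro _ ⟨i, j, hij, rfl⟩
  have := monomial_mem_weightedIdeal s' y' (n := n') (k := k) (i := a * i) (j := b * i + j)
    (hij.trans_eq (by rw [hn]; ring))
  have e : φ (s ^ i * y ^ j) = s' ^ (a * i) * y' ^ (b * i + j) := by
    rw [map_mul, map_pow, map_pow, hs, hy]; ring
  rwa [SetLike.mem_coe, Ideal.mem_comap, e]

namespace IsParameterPair

variable [IsLocalRing A] [IsLocalRing A'] {s y : A} {s' y' : A'}

lemma left_mem_maximalIdeal (h : IsParameterPair s y) : s ∈ IsLocalRing.maximalIdeal A := by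
  rw [h.span_eq]; exact Ideal.subset_span (by simp)

lemma right_mem_maximalIdeal (h : IsParameterPair s y) : y ∈ IsLocalRing.maximalIdeal A := by
  rw [h.span_eq]; exact Ideal.subset_span (by simp)

lemma weightedIdeal_one (h : IsParameterPair s y) (k : ℕ) :
    weightedIdeal s y 1 k = IsLocalRing.maximalIdeal A ^ k := by
  rw [SurfaceCovering.weightedIdeal_one, h.span_eq]

lemma dvd_symm (h : IsParameterPair s y) {a : A} (ha : y ∣ s * a) : y ∣ a := by
  obtain ⟨b, hb⟩ := ha
  obtain ⟨c, rfl⟩ := h.dvd b ⟨a, hb.symm⟩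
  refine ⟨c, (mul_cancel_left_mem_nonZeroDivisors h.left_mem).1 ?_⟩
  rw [hb]; ring

lemma dvd_of_dvd_right_pow_mul (h : IsParameterPair s y) (l : ℕ) {a : A} (ha : s ∣ y ^ l * a) :
    s ∣ a := by
  induction l with
  | zero => simpa using ha
  | succ l ih => exact ih (h.dvd _ (by rwa [← mul_assoc, ← pow_succ']))

lemma dvd_of_dvd_left_pow_mul (h : IsParameterPair s y) (l : ℕ) {a : A} (ha : y ∣ s ^ l * a) :
    y ∣ a := by
  induction l with
  | zero => simpa using ha
  | succ l ih => exact ih (h.dvd_symm (by rwa [← mul_assoc, ← pow_succ']))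

lemma mem_of_left_mul_mem (h : IsParameterPair s y) {n k : ℕ} {g : A}
    (hg : s * g ∈ weightedIdeal s y n (k + n)) : g ∈ weightedIdeal s y n k := by
  obtain ⟨c, u, hu, e⟩ := mem_weightedIdeal_iff.1 hg
  rw [Nat.add_sub_cancel] at hu
  obtain ⟨d, rfl⟩ := h.dvd_of_dvd_right_pow_mul (k + n) (a := c) ⟨g - u, by rw [mul_sub, e]; ring⟩
  have : g = d * y ^ (k + n) + u := by
    refine (mul_cancel_left_mem_nonZeroDivisors h.left_mem).1 ?_
    rw [e]; ring
  rw [this]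
  refine add_mem (Ideal.mul_mem_left _ _ (weightedIdeal_antitone s y n (Nat.le_add_right k n) ?_)) hu
  simpa using monomial_mem_weightedIdeal s y (n := n) (k := k + n) (i := 0) (j := k + n) (by simp)

lemma mem_of_left_pow_mul_mem (h : IsParameterPair s y) {n k : ℕ} (l : ℕ) {g : A}
    (hg : s ^ l * g ∈ weightedIdeal s y n (k + l * n)) : g ∈ weightedIdeal s y n k := by
  induction l with
  | zero => simpa using hg
  | succ l ih =>
    refine ih (h.mem_of_left_mul_mem ?_)
    rwa [← mul_assoc, ← pow_succ', add_assoc, ← Nat.succ_mul]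

/-- In `y * g = c * y ^ (k + 1) + s * u` regularity forces `y ∣ u`. Cancelling `y` leaves the same
question for `u / y` in weight lower by `n`, and `1 ≤ n` makes this terminate. -/
lemma mem_of_right_mul_mem (h : IsParameterPair s y) {n : ℕ} (hn : 1 ≤ n) {k : ℕ} {g : A}
    (hg : y * g ∈ weightedIdeal s y n (k + 1)) : g ∈ weightedIdeal s y n k := by
  induction k using Nat.strong_induction_on generalizing g with
  | _ k ih =>
    rcases k with _ | k
    · simp [weightedIdeal_zero]
    obtain ⟨c, u, hu, e⟩ := mem_weightedIdeal_iff.1 hg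
    obtain ⟨v, rfl⟩ := h.dvd_symm (a := u) ⟨g - c * y ^ (k + 1), by rw [mul_sub, e]; ring⟩
    have : g = c * y ^ (k + 1) + s * v := by
      refine (mul_cancel_left_mem_nonZeroDivisors h.right_mem).1 ?_
      rw [e]; ring
    refine mem_weightedIdeal_iff.2 ⟨c, v, ?_, this⟩
    by_cases hk : k + 1 ≤ n
    · simp [Nat.sub_eq_zero_of_le hk, weightedIdeal_zero]
    · refine ih _ (by omega) ?_
      rwa [show k + 1 - n + 1 = k + 1 + 1 - n by omega]

lemma mem_of_right_pow_mul_mem (h : IsParameterPair s y) {n : ℕ} (hn : 1 ≤ n) {k : ℕ} (l : ℕ)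
    {g : A} (hg : y ^ l * g ∈ weightedIdeal s y n (k + l)) : g ∈ weightedIdeal s y n k := by
  induction l with
  | zero => simpa using hg
  | succ l ih =>
    refine ih (h.mem_of_right_mul_mem hn ?_)
    rwa [← mul_assoc, ← pow_succ', add_assoc]

/-- A local homomorphism that maps parameters to monomials in parameters preserves the weighted
order. -/
lemma mem_weightedIdeal_succ (h : IsParameterPair s y) (h' : IsParameterPair s' y')
    (φ : A →+* A') [IsLocalHom φ] {a b n n' : ℕ}
    (hs : φ s = y' ^ b * s' ^ a) (hy : φ y = y') (hn : n = b + a * n') (ha : 1 ≤ a) (hn' : 1 ≤ n')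
    {k : ℕ} {x : A} (hx : x ∈ weightedIdeal s y n k)
    (hx' : φ x ∈ weightedIdeal s' y' n' (k + 1)) : x ∈ weightedIdeal s y n (k + 1) := by
  have hn1 : 1 ≤ n := by rw [hn]; nlinarith
  induction k using Nat.strong_induction_on generalizing x with
  | _ k ih =>
    obtain ⟨c, u, hu, rfl⟩ := mem_weightedIdeal_iff.1 hx
    obtain ⟨c', u', -, e⟩ := mem_weightedIdeal_iff.1 hx'
    have hyk : y ^ k ∈ weightedIdeal s y n k := by
      simpa using monomial_mem_weightedIdeal s y (n := n) (k := k) (i := 0) (j := k) (by simp)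
    -- Modulo `s'` the hypothesis on `φ x` reads `φ c * y' ^ k ≡ c' * y' ^ (k + 1)`, so `φ c` lies
    -- in `(s', y')`. As `φ` is local, `c` is not a unit and `c * y ^ k` gains at least one unit of
    -- weight.
    have hc : c * y ^ k ∈ weightedIdeal s y n (k + 1) := by
      have hdvd : s' ∣ φ c - c' * y' := by
        refine h'.dvd_of_dvd_right_pow_mul k ?_
        obtain ⟨a, rfl⟩ := Nat.exists_eq_add_of_le' ha
        refine ⟨u' - y' ^ b * s' ^ a * φ u, ?_⟩
        rw [map_add, map_mul, map_mul, map_pow, hy, hs] at e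
        linear_combination e
      have hcm : c ∈ IsLocalRing.maximalIdeal A := by
        rw [IsLocalRing.mem_maximalIdeal, mem_nonunits_iff, ← isUnit_map_iff φ,
          ← mem_nonunits_iff, ← IsLocalRing.mem_maximalIdeal]
        have := add_mem (Ideal.mem_of_dvd _ hdvd h'.left_mem_maximalIdeal)
          (Ideal.mul_mem_left _ c' h'.right_mem_maximalIdeal)
        simpa using this
      rw [h.span_eq] at hcm
      obtain ⟨p, q, rfl⟩ := Ideal.mem_span_pair.1 hcm
      rw [add_mul, mul_assoc, mul_assoc]
      exact add_mem (Ideal.mul_mem_left _ _ (weightedIdeal_antitone s y n (by omega)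
        (left_mul_mem_weightedIdeal hyk)))
        (Ideal.mul_mem_left _ _ (right_mul_mem_weightedIdeal hyk))
    refine add_mem hc ?_
    by_cases hkn : k < n
    · exact weightedIdeal_antitone s y n (by omega) (left_mul_mem_weightedIdeal hu)
    -- What remains is `s * u`. Cancelling the monomial `φ s` of weight `n` leaves the statement for
    -- `u` in weight `k - n`.
    · have hsu : φ (s * u) ∈ weightedIdeal s' y' n' (k + 1) := by
        rw [map_add] at hx'
        exact (add_mem_cancel_left (map_mem_weightedIdeal φ hs hy hn hc)).1 hx'
      rw [map_mul, hs, mul_assoc,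
        show k + 1 = (k - n + 1) + a * n' + b by omega] at hsu
      have := ih (k - n) (by omega) hu
        (h'.mem_of_left_pow_mul_mem a (h'.mem_of_right_pow_mul_mem hn' b hsu))
      exact weightedIdeal_antitone s y n (by omega) (left_mul_mem_weightedIdeal this)

omit [IsLocalRing A'] in
lemma pow_dvd_map (h : IsParameterPair s y) (φ : A →+* A') (hs : φ s = y' * s')
    (hy : φ y = y') {k : ℕ} {x : A} (hx : x ∈ IsLocalRing.maximalIdeal A ^ k) :
    y' ^ k ∣ φ x := by
  rw [← Ideal.mem_span_singleton, ← Ideal.span_singleton_pow]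
  have : IsLocalRing.maximalIdeal A ≤ (Ideal.span {y'}).comap φ := by
    rw [h.span_eq, Ideal.span_le]
    rintro z (rfl | rfl)
    · simp [hs, Ideal.mem_span_singleton]
    · simp [hy]
  exact Ideal.le_comap_pow φ k (Ideal.pow_right_mono this k hx)

/-- A local equation of the strict transform under a blow-up is, modulo the equation `y'` of the
exceptional divisor, a unit times a power of the other parameter. -/
lemma exists_unit_mul_pow (h : IsParameterPair s y) (h' : IsParameterPair s' y')
    (φ : A →+* A') [IsLocalHom φ] (hs : φ s = y' * s') (hy : φ y = y') {k : ℕ} {x : A}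
    (hx : x ∈ IsLocalRing.maximalIdeal A ^ k) (hx' : x ∉ IsLocalRing.maximalIdeal A ^ (k + 1))
    {g : A'} (hg : φ x = y' ^ k * g) : ∃ r u, IsUnit u ∧ y' ∣ g - u * s' ^ r := by
  induction k generalizing x g with
  | zero =>
    refine ⟨0, g, ?_, by simp⟩
    have : IsUnit x := by simpa using hx'
    simpa [hg] using this.map φ
  | succ k ih =>
    rw [← h.weightedIdeal_one] at hx
    obtain ⟨c, v, hv, rfl⟩ := mem_weightedIdeal_iff.1 hx
    rw [Nat.add_sub_cancel, h.weightedIdeal_one] at hv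
    obtain ⟨w, hw⟩ := h.pow_dvd_map φ hs hy hv
    have hgw : g = φ c + s' * w := by
      refine (mul_cancel_left_mem_nonZeroDivisors (pow_mem h'.right_mem (k + 1))).1 ?_
      rw [← hg, map_add, map_mul, map_mul, map_pow, hs, hy, hw]; ring
    -- Here `c` is the coefficient of the pure power of `y` in the initial form of the element. If
    -- it is a unit, so is `g`, and `r = 0`. Otherwise that term has higher order, `s` splits off
    -- the initial form, and `r` grows by one.
    by_cases hc : IsUnit c
    · refine ⟨0, g, ?_, by simp⟩
      rw [hgw]
      by_contra hu
      refine (IsLocalRing.mem_maximalIdeal _).1 ?_ (hc.map φ)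
      have := sub_mem ((IsLocalRing.mem_maximalIdeal _).2 hu)
        (Ideal.mul_mem_right w _ h'.left_mem_maximalIdeal)
      simpa using this
    · have hcm : c ∈ IsLocalRing.maximalIdeal A := hc
      have hcy : c * y ^ (k + 1) ∈ IsLocalRing.maximalIdeal A ^ (k + 1 + 1) := by
        rw [pow_succ']
        exact Ideal.mul_mem_mul hcm (Ideal.pow_mem_pow h.right_mem_maximalIdeal _)
      have hv2 : v ∉ IsLocalRing.maximalIdeal A ^ (k + 1) := fun hv2 ↦ hx' <| add_mem hcy <| by
        rw [pow_succ']
        exact Ideal.mul_mem_mul h.left_mem_maximalIdeal hv2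
      obtain ⟨r, u, hu, d⟩ := ih hv hv2 hw
      have hcd : y' ∣ φ c := by
        rw [h.span_eq] at hcm
        obtain ⟨p, q, rfl⟩ := Ideal.mem_span_pair.1 hcm
        exact ⟨φ p * s' + φ q, by rw [map_add, map_mul, map_mul, hs, hy]; ring⟩
      refine ⟨r + 1, u, hu, ?_⟩
      have := dvd_add hcd (dvd_mul_of_dvd_right d s')
      rw [hgw]
      convert this using 1
      ring

/-- Take `μ` to be the order of `f` for the maximal ideal; dividing `φ f` by `y' ^ μ` lowers the
weighted order by `μ`. That `g` is prime to `y'` holds because `g` is a unit times a power of `s'`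
modulo `y'`. -/
lemma exists_strictTransform (h : IsParameterPair s y) (h' : IsParameterPair s' y')
    (φ : A →+* A') [IsLocalHom φ] (hs : φ s = y' * s') (hy : φ y = y') {n : ℕ} (hn : 1 ≤ n)
    {m : ℕ} {f : A} (hf : f ∈ weightedIdeal s y (n + 1) m)
    (hf' : f ∉ weightedIdeal s y (n + 1) (m + 1)) :
    ∃ μ m' g, m = μ + m' ∧ f ∈ IsLocalRing.maximalIdeal A ^ μ ∧
      f ∉ IsLocalRing.maximalIdeal A ^ (μ + 1) ∧ φ f = y' ^ μ * g ∧ (∀ x, y' ∣ g * x → y' ∣ x) ∧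
      g ∈ weightedIdeal s' y' n m' ∧ g ∉ weightedIdeal s' y' n (m' + 1) := by
  classical
  -- The k-th power of the maximal ideal lies in the ideal of weight k, so the order of `f` is
  -- finite, and at most `m`, without Krull's intersection theorem.
  have hfin : ∃ μ, f ∉ IsLocalRing.maximalIdeal A ^ (μ + 1) :=
    ⟨m, fun hm ↦ hf' (weightedIdeal_one_le (by omega) s y _ (by rwa [h.weightedIdeal_one]))⟩
  obtain ⟨μ, hμ', hμ⟩ : ∃ μ, f ∉ IsLocalRing.maximalIdeal A ^ (μ + 1) ∧
      f ∈ IsLocalRing.maximalIdeal A ^ μ := by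
    refine ⟨Nat.find hfin, Nat.find_spec hfin, ?_⟩
    rcases hk : Nat.find hfin with _ | k
    · simp
    · have := Nat.find_min hfin (m := k) (by omega)
      rwa [not_not] at this
  have hμm : μ ≤ m := by
    by_contra hlt
    exact hf' (weightedIdeal_one_le (by omega) s y _
      (by rw [h.weightedIdeal_one]; exact Ideal.pow_le_pow_right (by omega) hμ))
  obtain ⟨m', rfl⟩ := Nat.exists_eq_add_of_le hμm
  obtain ⟨g, hg⟩ := h.pow_dvd_map φ hs hy hμ
  have hs1 : φ s = y' ^ 1 * s' ^ 1 := by simpa using hs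
  refine ⟨μ, m', g, rfl, hμ, hμ', hg, ?_, ?_, ?_⟩
  · intro x hx
    obtain ⟨r, u, hu, d⟩ := h.exists_unit_mul_pow h' φ hs hy hμ hμ' hg
    have h1 : y' ∣ u * (s' ^ r * x) := by
      have := dvd_sub hx (dvd_mul_of_dvd_left d x)
      convert this using 1
      ring
    exact h'.dvd_of_dvd_left_pow_mul r (hu.dvd_mul_left.1 h1)
  · refine h'.mem_of_right_pow_mul_mem hn μ ?_
    rw [← hg, add_comm]
    exact map_mem_weightedIdeal φ hs1 hy (by omega) hf
  · intro hg'
    refine hf' (h.mem_weightedIdeal_succ h' φ hs1 hy (by omega) le_rfl hn hf ?_)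
    rw [hg, show μ + m' + 1 = m' + 1 + μ by omega]
    exact right_pow_mul_mem_weightedIdeal hg' μ

/-- The order with respect to the maximal ideal of a totally ramified cyclic covering restricts to
the weighted order. -/
lemma weightedIdeal_of_pow (h : IsParameterPair s y) (h' : IsParameterPair s' y')
    (φ : A →+* A') [IsLocalHom φ] {n : ℕ} (hn : 1 ≤ n) (hs : φ s = s' ^ n) (hy : φ y = y')
    {m : ℕ} {f : A} (hf : φ f ∈ IsLocalRing.maximalIdeal A' ^ m)
    (hf' : φ f ∉ IsLocalRing.maximalIdeal A' ^ (m + 1)) :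
    f ∈ weightedIdeal s y n m ∧ f ∉ weightedIdeal s y n (m + 1) := by
  have hs1 : φ s = y' ^ 0 * s' ^ n := by simpa using hs
  rw [← h'.weightedIdeal_one] at hf hf'
  refine ⟨?_, fun hm ↦ hf' (map_mem_weightedIdeal φ hs1 hy (by omega) hm)⟩
  -- `mem_weightedIdeal_succ` raises the weight by one only, so the bound is reached step by step
  -- from weight `0`.
  have : ∀ k ≤ m, f ∈ weightedIdeal s y n k := by
    intro k hk
    induction k with
    | zero => simp [weightedIdeal_zero]
    | succ k ih =>
      exact h.mem_weightedIdeal_succ h' φ hs1 hy (by omega) hn le_rfl (ih (by omega))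
        (weightedIdeal_antitone s' y' 1 hk hf)
  exact this m le_rfl

end IsParameterPair
end Weighted
end SurfaceCovering

namespace SurfaceCovering

/-! ### The affine chart A[s / y] and its local rings. -/

section BlowUpChart

open Polynomial

variable {A : Type u} [CommRing A]

/-- The chart `A[s / y]` of the blow-up of the ideal `(s, y)`. -/
noncomputable abbrev BlowUpChart (s y : A) : Type u := A[X] ⧸ Ideal.span {C y * X - C s}

namespace BlowUpChart

variable (s y : A)

/-- The quotient `s / y` in the chart. -/
noncomputable abbrev x : BlowUpChart s y := Ideal.Quotient.mk _ X

lemma algebraMap_mul_x : algebraMap A (BlowUpChart s y) y * x s y = algebraMap A _ s := by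
  have : Ideal.Quotient.mk (Ideal.span {C y * X - C s}) (C y * X - C s) = 0 :=
    Ideal.Quotient.eq_zero_iff_mem.2 (Ideal.mem_span_singleton_self _)
  rw [map_sub, map_mul, sub_eq_zero] at this
  exact this

lemma exists_dvd_sub (r : BlowUpChart s y) :
    ∃ a : A, x s y ∣ r - algebraMap A (BlowUpChart s y) a := by
  obtain ⟨p, rfl⟩ := Ideal.Quotient.mk_surjective r
  refine ⟨p.coeff 0, Ideal.Quotient.mk _ p.divX, ?_⟩
  have := congr_arg (Ideal.Quotient.mk (Ideal.span {C y * X - C s})) p.divX_mul_X_add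
  rw [map_add, map_mul] at this
  rw [← this]
  change _ + Ideal.Quotient.mk _ (C _) - Ideal.Quotient.mk _ (C _) = _
  ring

variable {s y}

lemma ext_of_algebraMap {R : Type*} [CommRing R] {f g : BlowUpChart s y →+* R}
    (h : ∀ a, f (algebraMap A _ a) = g (algebraMap A _ a)) (hx : f (x s y) = g (x s y)) :
    f = g := by
  refine Ideal.Quotient.ringHom_ext (Polynomial.ringHom_ext h hx)

/-- The homomorphism from the chart determined by a quotient of `s` by `y`. -/
noncomputable def lift {R : Type*} [CommRing R] (φ : A →+* R) (z : R) (h : φ y * z = φ s) :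
    BlowUpChart s y →+* R :=
  Ideal.Quotient.lift _ (eval₂RingHom φ z) fun a ha ↦ by
    obtain ⟨b, rfl⟩ := Ideal.mem_span_singleton.1 ha
    rw [map_mul]
    simp [h]

@[simp]
lemma lift_algebraMap {R : Type*} [CommRing R] (φ : A →+* R) (z : R) (h : φ y * z = φ s) (a : A) :
    lift φ z h (algebraMap A _ a) = φ a := by
  change Ideal.Quotient.lift _ _ _ (Ideal.Quotient.mk _ (C a)) = _
  simp

@[simp]
lemma lift_x {R : Type*} [CommRing R] (φ : A →+* R) (z : R) (h : φ y * z = φ s) :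
    lift φ z h (x s y) = z := by
  change Ideal.Quotient.lift _ _ _ (Ideal.Quotient.mk _ X) = _
  simp

variable [IsLocalRing A] (h : IsParameterPair s y)
include h

/-- If `p * X` is a multiple `(y X - s) q` of the relation, comparing constant terms gives `s * q(0)
= 0`; hence `X ∣ q`, and `X` cancels. -/
lemma x_mem_nonZeroDivisors : x s y ∈ nonZeroDivisors (BlowUpChart s y) := by
  rw [mem_nonZeroDivisors_iff_right]
  intro r hr
  obtain ⟨p, rfl⟩ := Ideal.Quotient.mk_surjective r
  rw [← map_mul, Ideal.Quotient.eq_zero_iff_mem, Ideal.mem_span_singleton] at hr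
  obtain ⟨q, hq⟩ := hr
  have h0 : s * q.coeff 0 = 0 := by
    have := congr_arg (coeff · 0) hq
    simpa [sub_mul, mul_assoc] using this
  have hq0 : q.coeff 0 = 0 := (mul_cancel_left_mem_nonZeroDivisors h.left_mem).1 (by rw [h0, mul_zero])
  obtain ⟨q', rfl⟩ := X_dvd_iff.2 hq0
  rw [Ideal.Quotient.eq_zero_iff_mem, Ideal.mem_span_singleton]
  refine ⟨q', ?_⟩
  refine (isRegular_X (R := A)).right ?_
  change p * X = _ * X
  rw [hq]; ring

/-- Modulo `y` the relation becomes `-s`, which is regular on `A / y`, coefficient by coefficient.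
-/
lemma y_mem_nonZeroDivisors : algebraMap A _ y ∈ nonZeroDivisors (BlowUpChart s y) := by
  rw [mem_nonZeroDivisors_iff_right]
  intro r hr
  obtain ⟨p, rfl⟩ := Ideal.Quotient.mk_surjective r
  change Ideal.Quotient.mk _ p * Ideal.Quotient.mk _ (C y) = 0 at hr
  rw [← map_mul, Ideal.Quotient.eq_zero_iff_mem, Ideal.mem_span_singleton] at hr
  obtain ⟨q, hq⟩ := hr
  have hd : C y ∣ q := by
    have h1 : C y ∣ C s * q := ⟨X * q - p, by linear_combination hq⟩
    rw [C_dvd_iff_dvd_coeff] at h1 ⊢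
    intro i
    exact h.dvd_symm (by simpa using h1 i)
  obtain ⟨q', rfl⟩ := hd
  rw [Ideal.Quotient.eq_zero_iff_mem, Ideal.mem_span_singleton]
  refine ⟨q', ?_⟩
  ext i
  refine (mul_cancel_left_mem_nonZeroDivisors h.right_mem).1 ?_
  have := congr_arg (coeff · i) hq
  rw [← coeff_C_mul, ← coeff_C_mul, mul_comm (C y) p, hq]
  congr 1
  ring

/-- The quotient of the chart by `x` is `A / s`, on which `y` is regular; on representatives this
concerns constant terms only. -/
lemma x_dvd_of_dvd_y_mul {c : BlowUpChart s y} (hc : x s y ∣ algebraMap A _ y * c) :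
    x s y ∣ c := by
  obtain ⟨d, hd⟩ := hc
  obtain ⟨p, rfl⟩ := Ideal.Quotient.mk_surjective c
  obtain ⟨e, rfl⟩ := Ideal.Quotient.mk_surjective d
  change Ideal.Quotient.mk _ (C y) * _ = _ at hd
  rw [← map_mul, ← map_mul, Ideal.Quotient.eq, Ideal.mem_span_singleton] at hd
  obtain ⟨q, hq⟩ := hd
  have h0 : y * p.coeff 0 = - (s * q.coeff 0) := by
    have := congr_arg (coeff · 0) hq
    simpa [sub_mul, mul_assoc] using this
  obtain ⟨a, ha⟩ := h.dvd _ ⟨-q.coeff 0, by rw [h0]; ring⟩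
  have := congr_arg (Ideal.Quotient.mk (Ideal.span {C y * X - C s})) p.divX_mul_X_add
  rw [map_add, map_mul] at this
  rw [← this, ha]
  refine dvd_add (dvd_mul_left _ _) ?_
  change _ ∣ algebraMap A (BlowUpChart s y) (s * a)
  rw [map_mul, ← algebraMap_mul_x]
  exact ⟨algebraMap A _ y * algebraMap A _ a, by ring⟩

lemma isParameterPair_localization (q : Ideal (BlowUpChart s y)) [q.IsPrime] (hx : x s y ∈ q)
    (hq : q.comap (algebraMap A _) = IsLocalRing.maximalIdeal A)
    (R : Type*) [CommRing R] [Algebra (BlowUpChart s y) R] [IsLocalization.AtPrime R q]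
    [IsLocalRing R] :
    IsParameterPair (algebraMap _ R (x s y)) (algebraMap _ R (algebraMap A (BlowUpChart s y) y)) where
  span_eq := by
    -- An element of `q` is congruent modulo `x` to an element of `A`, which then lies in the
    -- maximal ideal `(s, y)`; and `s = y * x`.
    have hqs : q = Ideal.span {x s y, algebraMap A _ y} := by
      apply le_antisymm
      · intro r hr
        obtain ⟨a, d, hd⟩ := exists_dvd_sub s y r
        have har : algebraMap A _ a ∈ q := by
          have := sub_mem hr (Ideal.mul_mem_right d q hx)
          rw [← hd] at this
          simpa using this
        rw [← Ideal.mem_comap, hq, h.span_eq] at har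
        obtain ⟨b, c, rfl⟩ := Ideal.mem_span_pair.1 har
        refine Ideal.mem_span_pair.2 ⟨d + algebraMap A _ (b * y), algebraMap A (BlowUpChart s y) c, ?_⟩
        rw [sub_eq_iff_eq_add] at hd
        rw [hd, map_add, map_mul, map_mul, map_mul, ← algebraMap_mul_x]
        ring
      · rw [Ideal.span_le]
        rintro z (rfl | rfl)
        · exact hx
        · rw [SetLike.mem_coe, ← Ideal.mem_comap, hq]
          exact h.right_mem_maximalIdeal
    have := IsLocalization.AtPrime.map_eq_maximalIdeal q R
    rw [← this, hqs, Ideal.map_span, Set.image_pair]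
  left_mem := IsLocalization.map_nonZeroDivisors_le q.primeCompl R
    (Submonoid.mem_map_of_mem _ (x_mem_nonZeroDivisors h))
  right_mem := IsLocalization.map_nonZeroDivisors_le q.primeCompl R
    (Submonoid.mem_map_of_mem _ (y_mem_nonZeroDivisors h))
  dvd := by
    rintro a ⟨b, hb⟩
    obtain ⟨c, σ, rfl⟩ := IsLocalization.exists_mk'_eq q.primeCompl a
    obtain ⟨d, τ, rfl⟩ := IsLocalization.exists_mk'_eq q.primeCompl b
    rw [← IsLocalization.mk'_one (M := q.primeCompl) R (algebraMap A _ y),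
      ← IsLocalization.mk'_one (M := q.primeCompl) R (x s y), ← IsLocalization.mk'_mul,
      ← IsLocalization.mk'_mul, IsLocalization.mk'_eq_iff_eq, IsLocalization.eq_iff_exists q.primeCompl] at hb
    obtain ⟨ρ, hρ⟩ := hb
    obtain ⟨e, he⟩ := x_dvd_of_dvd_y_mul h (c := ρ * τ * c) ⟨ρ * σ * d, by
      simp only [one_mul] at hρ
      linear_combination hρ⟩
    refine ⟨IsLocalization.mk' R e (ρ * τ * σ), ?_⟩
    rw [← IsLocalization.mk'_one (M := q.primeCompl) R (x s y), ← IsLocalization.mk'_mul, ← he]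
    rw [IsLocalization.mk'_eq_iff_eq]
    congr 1
    push_cast
    ring

end BlowUpChart

end BlowUpChart
end SurfaceCovering

namespace SurfaceCovering

/-! ### Ideal sheaves: inverse images and stalks. -/

section Stalks

variable {X Y : Scheme.{u}}

/-- By the adjunction between `comap` and `map` of ideal sheaves, the same ideals `K` contain both
sides. -/
lemma ideal_comap_top [IsAffine X] [IsAffine Y] (I : Y.IdealSheafData) (f : X ⟶ Y) :
    (I.comap f).ideal ⟨⊤, isAffineOpen_top X⟩ =
      (I.ideal ⟨⊤, isAffineOpen_top Y⟩).map f.appTop.hom := by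
  have key : ∀ K : X.IdealSheafData, (I.comap f).ideal ⟨⊤, isAffineOpen_top X⟩ ≤
      K.ideal ⟨⊤, isAffineOpen_top X⟩ ↔
      (I.ideal ⟨⊤, isAffineOpen_top Y⟩).map f.appTop.hom ≤ K.ideal ⟨⊤, isAffineOpen_top X⟩ := by
    intro K
    rw [Ideal.map_le_iff_le_comap]
    have hmap := Scheme.IdealSheafData.ideal_map K f ⟨⊤, isAffineOpen_top Y⟩ (isAffineOpen_top X)
    change _ ↔ _ ≤ Ideal.comap (f.app ⊤).hom (K.ideal ⟨f ⁻¹ᵁ ⊤, isAffineOpen_top X⟩)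
    rw [← hmap]
    constructor
    · intro h
      exact Scheme.IdealSheafData.le_map_iff_comap_le.2 (Scheme.IdealSheafData.le_of_isAffine h) _
    · intro h
      exact Scheme.IdealSheafData.le_map_iff_comap_le.1 (Scheme.IdealSheafData.le_of_isAffine h) _
  apply le_antisymm
  · have := (key (Scheme.IdealSheafData.ofIdealTop
      ((I.ideal ⟨⊤, isAffineOpen_top Y⟩).map f.appTop.hom)))
    have e : (Scheme.IdealSheafData.ofIdealTop
      ((I.ideal ⟨⊤, isAffineOpen_top Y⟩).map f.appTop.hom)).ideal ⟨⊤, isAffineOpen_top X⟩ =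
        (I.ideal ⟨⊤, isAffineOpen_top Y⟩).map f.appTop.hom :=
      Scheme.IdealSheafData.equivOfIsAffine.apply_symm_apply _
    rw [e] at this
    exact this.2 le_rfl
  · exact (key _).1 le_rfl

lemma ideal_comap_ι (I : X.IdealSheafData) (V : X.affineOpens) [IsAffine V.1] :
    (I.comap V.1.ι).ideal ⟨⊤, isAffineOpen_top _⟩ =
      (I.ideal V).map V.1.topIso.inv.hom := by
  rw [Scheme.IdealSheafData.ideal_comap_of_isOpenImmersion]
  have h1 := I.map_ideal (U := ⟨V.1.ι ''ᵁ ⊤, (isAffineOpen_top V.1).image_of_isOpenImmersion V.1.ι⟩)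
    (V := V) (by simp)
  rw [← h1]
  have h2 := Ideal.comap_symm (I := (I.ideal V).map (X.presheaf.map (homOfLE
      (show V.1.ι ''ᵁ ⊤ ≤ V.1 by simp)).op).hom) (V.1.ι.appIso ⊤).commRingCatIsoToRingEquiv
  refine h2.trans ?_
  refine (Ideal.map_map (X.presheaf.map (homOfLE (show V.1.ι ''ᵁ ⊤ ≤ V.1 by simp)).op).hom
    (V.1.ι.appIso ⊤).hom.hom).trans ?_
  congr 1
  have : V.1.topIso.inv = X.presheaf.map (homOfLE (show V.1.ι ''ᵁ ⊤ ≤ V.1 by simp)).op ≫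
    (V.1.ι.appIso ⊤).hom := by
    simp only [Scheme.Opens.topIso_inv, Scheme.Opens.ι_appIso, Iso.refl_hom]
    exact (Category.comp_id _).symm
  rw [this]
  rfl

lemma ideal_comap (I : Y.IdealSheafData) (f : X ⟶ Y) (U : Y.affineOpens) (V : X.affineOpens)
    (h : V.1 ≤ f ⁻¹ᵁ U.1) : (I.comap f).ideal V = (I.ideal U).map (f.appLE U.1 V.1 h).hom := by
  have : IsAffine V.1 := V.2
  have : IsAffine U.1 := U.2
  have e : V.1.ι ≫ f = f.resLE U.1 V.1 h ≫ U.1.ι := by simp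
  have h1 := ideal_comap_ι (I.comap f) V
  rw [← Scheme.IdealSheafData.comap_comp, e, Scheme.IdealSheafData.comap_comp, ideal_comap_top,
    ideal_comap_ι, Ideal.map_map] at h1
  have h2 := congr_arg (Ideal.map V.1.topIso.hom.hom) h1
  have e1 : V.1.topIso.hom.hom.comp ((f.resLE U.1 V.1 h).appTop.hom.comp U.1.topIso.inv.hom) =
      (f.appLE U.1 V.1 h).hom := by
    rw [← CommRingCat.hom_comp, ← CommRingCat.hom_comp, Scheme.Hom.appTop,
      Scheme.Hom.resLE_app_top, Category.assoc, Category.assoc, Category.assoc, Iso.inv_hom_id,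
      Category.comp_id, Iso.inv_hom_id_assoc]
  rw [Ideal.map_map, e1, Ideal.map_map, ← CommRingCat.hom_comp, Iso.inv_hom_id] at h2
  rw [h2]
  exact (Ideal.map_id _).symm

lemma map_germ_ideal (I : X.IdealSheafData) (x : X) {U V : X.affineOpens} (h : U ≤ V)
    (hU : x ∈ U.1) :
    (I.ideal V).map (X.presheaf.germ V.1 x (h hU)).hom =
      (I.ideal U).map (X.presheaf.germ U.1 x hU).hom := by
  rw [← I.map_ideal h, Ideal.map_map, ← CommRingCat.hom_comp]
  erw [X.presheaf.germ_res]

/-- Two affine neighbourhoods of `x` share a basic open neighbourhood, so all terms of the supremum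
coincide. -/
lemma stalkIdeal_eq (I : X.IdealSheafData) (x : X) (U : X.affineOpens) (hx : x ∈ U.1) :
    stalkIdeal I x = (I.ideal U).map (X.presheaf.germ U.1 x hx).hom := by
  apply le_antisymm
  · refine iSup₂_le fun V hV ↦ ?_
    obtain ⟨f, g, e, hf⟩ := exists_basicOpen_le_affine_inter U.2 V.2 x ⟨hx, hV⟩
    have h1 := map_germ_ideal I x (U := X.affineBasicOpen f) (V := U) (X.basicOpen_le f) hf
    have h2 := map_germ_ideal I x (U := X.affineBasicOpen f) (V := V)
      (e.trans_le (X.basicOpen_le g)) hf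
    exact (h2.trans h1.symm).le
  · exact le_iSup₂ (f := fun (U : X.affineOpens) (hy : x ∈ U.1) ↦
      (I.ideal U).map (X.presheaf.germ U.1 x hy).hom) U hx

lemma stalkIdeal_comap (I : Y.IdealSheafData) (f : X ⟶ Y) (x : X) :
    stalkIdeal (I.comap f) x = (stalkIdeal I (f x)).map (f.stalkMap x).hom := by
  obtain ⟨_, ⟨U, hU, rfl⟩, hxU, -⟩ := Y.isBasis_affineOpens.exists_subset_of_mem_open
    (Set.mem_univ (f x)) isOpen_univ
  obtain ⟨_, ⟨V, hV, rfl⟩, hxV, hVU⟩ := X.isBasis_affineOpens.exists_subset_of_mem_open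
    hxU (f ⁻¹ᵁ U).2
  rw [stalkIdeal_eq _ _ ⟨V, hV⟩ hxV, stalkIdeal_eq _ _ ⟨U, hU⟩ hxU, ideal_comap I f ⟨U, hU⟩ ⟨V, hV⟩ hVU,
    Ideal.map_map, Ideal.map_map, ← CommRingCat.hom_comp, ← CommRingCat.hom_comp,
    Scheme.Hom.germ_stalkMap, Scheme.Hom.app_eq_appLE]
  rw [← X.presheaf.germ_res (homOfLE hVU) x hxV, ← Category.assoc, Scheme.Hom.appLE_map]

lemma mem_support_iff_stalkIdeal (I : X.IdealSheafData) (x : X) :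
    x ∈ I.support ↔ stalkIdeal I x ≠ ⊤ := by
  obtain ⟨_, ⟨U, hU, rfl⟩, hxU, -⟩ := X.isBasis_affineOpens.exists_subset_of_mem_open
    (Set.mem_univ x) isOpen_univ
  rw [Scheme.IdealSheafData.mem_support_iff_of_mem (U := ⟨U, hU⟩) hxU, stalkIdeal_eq _ _ ⟨U, hU⟩ hxU,
    Scheme.mem_zeroLocus_iff]
  simp only [Scheme.mem_basicOpen _ _ _ hxU]
  rw [← not_iff_not, not_ne_iff]
  push Not
  constructor
  · rintro ⟨a, ha, hu⟩
    exact Ideal.eq_top_of_isUnit_mem _ (Ideal.mem_map_of_mem _ ha) hu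
  · intro h
    by_contra! hc
    have : (I.ideal ⟨U, hU⟩).map (X.presheaf.germ U x hxU).hom ≤
        IsLocalRing.maximalIdeal (X.presheaf.stalk x) :=
      Ideal.map_le_iff_le_comap.2 fun a ha ↦ hc a ha
    exact (IsLocalRing.maximalIdeal.isMaximal _).ne_top (top_le_iff.1 (h ▸ this))

lemma stalkIdeal_pointIdeal (x : X) (hx : IsClosed ({x} : Set X)) :
    stalkIdeal (pointIdeal x) x = IsLocalRing.maximalIdeal (X.presheaf.stalk x) := by
  obtain ⟨_, ⟨U, hU, rfl⟩, hxU, -⟩ := X.isBasis_affineOpens.exists_subset_of_mem_open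
    (Set.mem_univ x) isOpen_univ
  replace hU : IsAffineOpen U := hU
  rw [stalkIdeal_eq _ _ ⟨U, hU⟩ hxU]
  have h1 : (pointIdeal x).ideal ⟨U, hU⟩ = (hU.primeIdealOf ⟨x, hxU⟩).asIdeal := by
    rw [pointIdeal, Scheme.IdealSheafData.vanishingIdeal_ideal]
    have : hU.fromSpec ⁻¹' (TopologicalSpace.Closeds.closure {x} : Set X) =
        {hU.primeIdealOf ⟨x, hxU⟩} := by
      rw [TopologicalSpace.Closeds.coe_closure, hx.closure_eq]
      ext z
      change hU.fromSpec z = x ↔ z = hU.primeIdealOf ⟨x, hxU⟩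
      refine Iff.trans ?_ (hU.fromSpec.isOpenEmbedding.injective.eq_iff
        (b := hU.primeIdealOf ⟨x, hxU⟩))
      rw [hU.fromSpec_primeIdealOf]
    exact (congr_arg PrimeSpectrum.vanishingIdeal this).trans
      (PrimeSpectrum.vanishingIdeal_singleton _)
  rw [h1]
  let := TopCat.Presheaf.algebra_section_stalk X.presheaf ⟨x, hxU⟩
  have := hU.isLocalization_stalk ⟨x, hxU⟩
  exact IsLocalization.AtPrime.map_eq_maximalIdeal (hU.primeIdealOf ⟨x, hxU⟩).asIdeal
    (X.presheaf.stalk x)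

end Stalks
end SurfaceCovering

namespace SurfaceCovering

/-! ### Closure of the complement of a divisor, as a saturation. -/

section StrictTransform

variable {X : Scheme.{u}}

lemma compl_support_inf_eq_basicOpen (J : X.IdealSheafData) {V : X.affineOpens} {e : Γ(X, V.1)}
    (he : J.ideal V = Ideal.span {e}) : J.support.compl ⊓ V.1 = X.basicOpen e := by
  ext x
  constructor
  · rintro ⟨hx, hxV⟩
    by_contra hxe
    refine hx ((Scheme.IdealSheafData.mem_support_iff_of_mem hxV).2 ?_)
    rw [he, Scheme.zeroLocus_span, Scheme.zeroLocus_singleton]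
    exact hxe
  · intro hx
    have hxV := X.basicOpen_le e hx
    refine ⟨fun hxJ ↦ ?_, hxV⟩
    have := (Scheme.IdealSheafData.mem_support_iff_of_mem hxV).1 hxJ
    rw [he, Scheme.zeroLocus_span, Scheme.zeroLocus_singleton] at this
    exact this hx

/-- The complement of a locally principal subscheme is locally a basic open set, so its inclusion is
affine. Quasi-compactness lets the kernel ideal sheaf be computed on sections over affine opens. -/
lemma quasiCompact_complement (J K : X.IdealSheafData) (hJ : IsEffectiveDivisor J) :
    QuasiCompact ((K.subschemeι ⁻¹ᵁ J.support.compl).ι ≫ K.subschemeι) := by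
  rw [← morphismRestrict_ι]
  have : IsAffineHom (Scheme.Opens.ι J.support.compl) := by
    refine isAffineHom_of_forall_exists_isAffineOpen _ fun x ↦ ?_
    obtain ⟨V, hx, e, -, he⟩ := hJ x
    refine ⟨V.1, hx, V.2, ?_⟩
    rw [← Scheme.Hom.isAffineOpen_iff_of_isOpenImmersion (Scheme.Opens.ι J.support.compl),
      Scheme.Hom.image_preimage_eq_opensRange_inf, Scheme.Opens.opensRange_ι,
      compl_support_inf_eq_basicOpen J he]
    exact V.2.basicOpen e
  infer_instance

lemma res_eq_zero_congr {U V W : X.Opens} (h : U = V) (hU : U ≤ W) (i : Opposite.op W ⟶ .op V)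
    {R : CommRingCat.{u}} (φ : R ⟶ Γ(X, W)) (r : R) :
    (φ ≫ X.presheaf.map (homOfLE hU).op) r = 0 ↔ (φ ≫ X.presheaf.map i) r = 0 := by
  subst h
  rfl

/-- Over `V` the complement of `J` is the basic open set of `e`, and a section dies in the
localization at `e` exactly when a power of `e` kills it. -/
lemma mem_ideal_ker_complement (J K : X.IdealSheafData) (hJ : IsEffectiveDivisor J)
    {V : X.affineOpens} {e : Γ(X, V.1)} (he : J.ideal V = Ideal.span {e}) (g : Γ(X, V.1)) :
    g ∈ ((K.subschemeι ⁻¹ᵁ J.support.compl).ι ≫ K.subschemeι).ker.ideal V ↔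
      ∃ N : ℕ, e ^ N * g ∈ K.ideal V := by
  have := quasiCompact_complement J K hJ
  have hV := V.2.isLocalization_basicOpen e
  have h1 : (∃ N : ℕ, e ^ N * g ∈ K.ideal V) ↔
      (X.presheaf.map (homOfLE (X.basicOpen_le e)).op).hom g ∈ K.ideal (X.affineBasicOpen e) := by
    rw [← K.map_ideal (U := X.affineBasicOpen e) (V := V) (X.basicOpen_le e)]
    have := IsLocalization.mk'_mem_map_algebraMap_iff (Submonoid.powers e) Γ(X, X.basicOpen e)
      (K.ideal V) g 1
    rw [IsLocalization.mk'_one] at this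
    refine Iff.trans ?_ this.symm
    simp [Submonoid.mem_powers_iff]
  rw [h1, ← K.ker_subschemeι_app, Scheme.Hom.ker_apply]
  have hW : (K.subschemeι ⁻¹ᵁ J.support.compl).ι ''ᵁ
      (K.subschemeι ⁻¹ᵁ J.support.compl).ι ⁻¹ᵁ K.subschemeι ⁻¹ᵁ V.1 =
      K.subschemeι ⁻¹ᵁ X.basicOpen e := by
    rw [Scheme.Hom.image_preimage_eq_opensRange_inf, Scheme.Opens.opensRange_ι,
      ← compl_support_inf_eq_basicOpen J he]
    rfl
  have h2 : ((K.subschemeι ⁻¹ᵁ J.support.compl).ι ≫ K.subschemeι).app V.1 = K.subschemeι.app V.1 ≫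
      K.subscheme.presheaf.map (homOfLE (hW.trans_le
        (K.subschemeι.preimage_mono (X.basicOpen_le e)))).op ≫
      𝟙 _ := by
    rw [Scheme.Hom.comp_app, Category.comp_id]
    rfl
  change ((K.subschemeι ⁻¹ᵁ J.support.compl).ι ≫ K.subschemeι).app V.1 g = 0 ↔
    (X.presheaf.map (homOfLE (X.basicOpen_le e)).op ≫ K.subschemeι.app (X.basicOpen e)) g = 0
  rw [h2, Scheme.Hom.naturality, Category.comp_id]
  exact res_eq_zero_congr hW _ _ _ _

end StrictTransform
end SurfaceCovering

namespace SurfaceCovering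

/-! ### Local rings of smooth curves at closed points. -/

section Uniformizer

/-- The maximal ideal is generated by one non-zero-divisor. -/
def HasUniformizer (L : Type*) [CommRing L] [IsLocalRing L] : Prop :=
  ∃ y ∈ nonZeroDivisors L, IsLocalRing.maximalIdeal L = Ideal.span {y}

lemma HasUniformizer.of_equiv {L L' : Type*} [CommRing L] [IsLocalRing L] [CommRing L']
    [IsLocalRing L'] (e : L ≃+* L') (h : HasUniformizer L) : HasUniformizer L' := by
  obtain ⟨y, hy, hm⟩ := h
  refine ⟨e y, ?_, ?_⟩
  · rw [mem_nonZeroDivisors_iff_right]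
    intro x hx
    have h0 : e.symm x * y = 0 := by
      apply e.injective
      rw [map_mul, e.apply_symm_apply, hx, map_zero]
    have := (mem_nonZeroDivisors_iff_right.1 hy) _ h0
    rwa [map_eq_zero_iff e.symm e.symm.injective] at this
  · have := IsLocalRing.map_maximalIdeal_of_surjective (e : L →+* L') e.surjective
    rw [← this, hm, Ideal.map_span, Set.image_singleton]
    rfl

/-- By the Nullstellensatz for Jacobson rings `q` lies over a maximal ideal `(π)` of `P`.
Unramifiedness makes `π` generate the maximal ideal of the local ring, and flatness keeps it
regular. -/
lemma hasUniformizer_of_etale {P S : Type*} (L : Type*) [CommRing P] [IsDomain P]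
    [IsPrincipalIdealRing P] [IsJacobsonRing P] (hP : ¬ IsField P) [CommRing S] [Algebra P S]
    [Algebra.Etale P S] (q : Ideal S) [q.IsMaximal] [CommRing L] [Algebra S L]
    [IsLocalization.AtPrime L q] [IsLocalRing L] : HasUniformizer L := by
  let p := q.under P
  have hp : p.IsMaximal := by
    let := Ideal.Quotient.field q
    have := finite_of_finite_type_of_isJacobsonRing P (S ⧸ q)
    have h := Ideal.isMaximal_comap_of_isIntegral_of_isMaximal (R := P) (⊥ : Ideal (S ⧸ q))
    have : (⊥ : Ideal (S ⧸ q)).comap (algebraMap P (S ⧸ q)) = p := by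
      ext x
      rw [Ideal.mem_comap, Ideal.mem_bot, IsScalarTower.algebraMap_apply P S (S ⧸ q)]
      exact Ideal.Quotient.eq_zero_iff_mem
    rwa [← this]
  obtain ⟨π, hπ⟩ : ∃ π, p = Ideal.span {π} := (IsPrincipalIdealRing.principal p).principal
  have hπ0 : π ≠ 0 := by
    rintro rfl
    refine Ring.ne_bot_of_isMaximal_of_not_isField hp hP ?_
    rw [hπ]; simp
  refine HasUniformizer.of_equiv
    (IsLocalization.algEquiv q.primeCompl (Localization.AtPrime q) L).toRingEquiv ?_
  let := Localization.AtPrime.algebraOfLiesOver p q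
  have hmax := ((Algebra.isUnramifiedAt_iff_map_eq P p q).1 inferInstance).2
  refine ⟨algebraMap P _ π, ?_, ?_⟩
  · have : Module.Flat P (Localization.AtPrime q) := Module.Flat.trans P S _
    have h1 : IsSMulRegular P π := by
      intro a b hab
      exact mul_left_cancel₀ hπ0 hab
    have h2 := h1.of_flat (S := Localization.AtPrime q)
    rw [mem_nonZeroDivisors_iff_right]
    intro x hx
    refine h2 ?_
    simpa [mul_comm] using hx
  · rw [← hmax, hπ, Ideal.map_span, Set.image_singleton]

/-- Locally the curve is étale over the affine line, whose coordinate ring is principal and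
Jacobson. -/
lemma hasUniformizer_stalk_of_smooth {k : Type u} [Field k] {Z : Scheme.{u}}
    (g : Z ⟶ Spec (CommRingCat.of k)) [hg : SmoothOfRelativeDimension 1 g] (q : Z)
    (hq : IsClosed ({q} : Set Z)) : HasUniformizer (Z.presheaf.stalk q) := by
  obtain ⟨U, hU, V, hV, hqV, e, hst⟩ := hg.exists_isStandardSmoothOfRelativeDimension q
  have hUtop : U = ⊤ := by
    rw [eq_top_iff]
    intro x _
    rw [Subsingleton.elim x (g q)]
    exact e hqV
  subst hUtop
  obtain ⟨φ, -, hφ⟩ := RingHom.IsStandardSmoothOfRelativeDimension.exists_etale_mvPolynomial hst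
  have ek : Γ(Spec (CommRingCat.of k), ⊤) ≃+* k :=
    (Scheme.ΓSpecIso (CommRingCat.of k)).commRingCatIsoToRingEquiv
  have eP : MvPolynomial (Fin 1) Γ(Spec (CommRingCat.of k), ⊤) ≃+* Polynomial k :=
    (MvPolynomial.mapEquiv (Fin 1) ek).trans (MvPolynomial.uniqueAlgEquiv k (Fin 1)).toRingEquiv
  have : IsDomain (MvPolynomial (Fin 1) Γ(Spec (CommRingCat.of k), ⊤)) := eP.toMulEquiv.isDomain (Polynomial k)
  have : IsPrincipalIdealRing (MvPolynomial (Fin 1) Γ(Spec (CommRingCat.of k), ⊤)) :=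
    IsPrincipalIdealRing.of_surjective (eP.symm : Polynomial k →+* _) eP.symm.surjective
  have : IsJacobsonRing (MvPolynomial (Fin 1) Γ(Spec (CommRingCat.of k), ⊤)) :=
    (isJacobsonRing_iso eP).2 inferInstance
  have hnf : ¬ IsField (MvPolynomial (Fin 1) Γ(Spec (CommRingCat.of k), ⊤)) :=
    fun h ↦ Polynomial.not_isField k (eP.symm.toMulEquiv.isField h)
  let := φ.toAlgebra
  have : Algebra.Etale (MvPolynomial (Fin 1) Γ(Spec (CommRingCat.of k), ⊤)) Γ(Z, V) := hφ
  let := TopCat.Presheaf.algebra_section_stalk Z.presheaf ⟨q, hqV⟩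
  have := hV.isLocalization_stalk ⟨q, hqV⟩
  have := hV.primeIdealOf_isMaximal_of_isClosed ⟨q, hqV⟩ hq
  exact hasUniformizer_of_etale (Z.presheaf.stalk q) hnf (hV.primeIdealOf ⟨q, hqV⟩).asIdeal

end Uniformizer

/-! ### Stalks of strict transforms and of closed subschemes. -/

section LocalRings

variable {X : Scheme.{u}}

/-- The stalk of the strict transform is the saturation of the stalk of the total transform. -/
lemma mem_stalkIdeal_ker_complement (J K : X.IdealSheafData) (hJ : IsEffectiveDivisor J) (x : X)
    {ε : X.presheaf.stalk x} (hε : stalkIdeal J x = Ideal.span {ε}) (g : X.presheaf.stalk x) :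
    g ∈ stalkIdeal ((K.subschemeι ⁻¹ᵁ J.support.compl).ι ≫ K.subschemeι).ker x ↔
      ∃ N : ℕ, ε ^ N * g ∈ stalkIdeal K x := by
  obtain ⟨V, hx, e, -, he⟩ := hJ x
  have hV := V.2.isLocalization_stalk ⟨x, hx⟩
  let := TopCat.Presheaf.algebra_section_stalk X.presheaf ⟨x, hx⟩
  set p := (V.2.primeIdealOf ⟨x, hx⟩).asIdeal
  have key := mem_ideal_ker_complement J K hJ he
  have hspan : Ideal.span {ε} = Ideal.span {algebraMap Γ(X, V.1) (X.presheaf.stalk x) e} := by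
    rw [← hε, stalkIdeal_eq J x V hx, he, Ideal.map_span, Set.image_singleton]
    rfl
  have hpow : (∃ N : ℕ, ε ^ N * g ∈ stalkIdeal K x) ↔
      ∃ N : ℕ, algebraMap Γ(X, V.1) (X.presheaf.stalk x) e ^ N * g ∈ stalkIdeal K x := by
    have h1 := Ideal.span_singleton_le_span_singleton.1 hspan.le
    have h2 := Ideal.span_singleton_le_span_singleton.1 hspan.ge
    constructor
    · rintro ⟨N, hN⟩
      exact ⟨N, Ideal.mem_of_dvd _ (mul_dvd_mul_right (pow_dvd_pow_of_dvd h2 N) g) hN⟩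
    · rintro ⟨N, hN⟩
      exact ⟨N, Ideal.mem_of_dvd _ (mul_dvd_mul_right (pow_dvd_pow_of_dvd h1 N) g) hN⟩
  rw [hpow, stalkIdeal_eq _ x V hx, stalkIdeal_eq K x V hx]
  obtain ⟨a, σ, rfl⟩ := IsLocalization.exists_mk'_eq p.primeCompl g
  have h1 (I : Ideal Γ(X, V.1)) (b : Γ(X, V.1)) :=
    IsLocalization.mk'_mem_map_algebraMap_iff p.primeCompl (X.presheaf.stalk x) I b σ
  refine (h1 _ a).trans ?_
  have h2 (N : ℕ) : algebraMap Γ(X, V.1) (X.presheaf.stalk x) e ^ N *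
      IsLocalization.mk' (X.presheaf.stalk x) a σ =
      IsLocalization.mk' (X.presheaf.stalk x) (e ^ N * a) σ := by
    rw [← map_pow, IsLocalization.mul_mk'_eq_mk'_of_mul]
  simp only [h2]
  refine Iff.trans ?_ (exists_congr fun N ↦ (h1 (K.ideal V) (e ^ N * a)).symm)
  constructor
  · rintro ⟨τ, hτ, h⟩
    obtain ⟨N, hN⟩ := (key _).1 h
    exact ⟨N, τ, hτ, by rwa [mul_left_comm]⟩
  · rintro ⟨N, τ, hτ, h⟩
    exact ⟨τ, hτ, (key _).2 ⟨N, by rwa [mul_left_comm]⟩⟩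

lemma ker_stalkMap_subschemeι (I : X.IdealSheafData) (z : I.subscheme) :
    RingHom.ker (I.subschemeι.stalkMap z).hom = stalkIdeal I (I.subschemeι z) := by
  obtain ⟨_, ⟨V, hV, rfl⟩, hx, -⟩ := X.isBasis_affineOpens.exists_subset_of_mem_open
    (Set.mem_univ (I.subschemeι z)) isOpen_univ
  replace hV : IsAffineOpen V := hV
  have hloc := hV.isLocalization_stalk ⟨I.subschemeι z, hx⟩
  let := TopCat.Presheaf.algebra_section_stalk X.presheaf ⟨I.subschemeι z, hx⟩
  have hz : z ∈ I.subschemeι ⁻¹ᵁ V := hx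
  have hW : IsAffineOpen (I.subschemeι ⁻¹ᵁ V) := hV.preimage I.subschemeι
  have hloc' := hW.isLocalization_stalk ⟨z, hz⟩
  let := TopCat.Presheaf.algebra_section_stalk I.subscheme.presheaf ⟨z, hz⟩
  have hgerm (a : Γ(X, V)) : I.subschemeι.stalkMap z (X.presheaf.germ V _ hx a) =
      I.subscheme.presheaf.germ _ z hz (I.subschemeι.app V a) :=
    Scheme.Hom.germ_stalkMap_apply _ _ _ _ _
  rw [stalkIdeal_eq I _ ⟨V, hV⟩ hx]
  apply le_antisymm
  · intro g hg
    obtain ⟨a, σ, rfl⟩ := IsLocalization.exists_mk'_eq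
      (hV.primeIdealOf ⟨I.subschemeι z, hx⟩).asIdeal.primeCompl g
    have ha : I.subscheme.presheaf.germ _ z hz (I.subschemeι.app V a) = 0 := by
      have h0 : (I.subschemeι.stalkMap z).hom (IsLocalization.mk' _ a σ) = 0 := hg
      rw [← hgerm]
      change (I.subschemeι.stalkMap z).hom (algebraMap _ _ a) = 0
      rw [← IsLocalization.mk'_spec _ a σ, map_mul, h0, zero_mul]
    obtain ⟨τ, hτ⟩ := (IsLocalization.map_eq_zero_iff
      (hW.primeIdealOf ⟨z, hz⟩).asIdeal.primeCompl (I.subscheme.presheaf.stalk z) _).1 ha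
    -- The denominator killing the image of `a` lifts to the ambient scheme; the lift is invertible
    -- at the point because the stalk map is local.
    obtain ⟨τ', hτ'⟩ := I.subschemeι_app_surjective ⟨V, hV⟩ τ.1
    have hmem : τ' * a ∈ I.ideal ⟨V, hV⟩ := by
      rw [← I.ker_subschemeι_app, RingHom.mem_ker, map_mul]
      change I.subschemeι.app V τ' * _ = 0
      rw [hτ', hτ]
    refine (IsLocalization.mk'_mem_map_algebraMap_iff _ _ _ _ _).2 ⟨τ', ?_, hmem⟩
    have hu : IsUnit (algebraMap _ (I.subscheme.presheaf.stalk z) τ.1) :=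
      IsLocalization.map_units _ τ
    rw [← hτ'] at hu
    have hu' : IsUnit ((I.subschemeι.stalkMap z).hom (X.presheaf.germ V _ hx τ')) := by
      change IsUnit (I.subschemeι.stalkMap z (X.presheaf.germ V _ hx τ'))
      rw [hgerm]
      exact hu
    exact (IsLocalization.AtPrime.isUnit_to_map_iff (X.presheaf.stalk (I.subschemeι z))
      (hV.primeIdealOf ⟨I.subschemeι z, hx⟩).asIdeal τ').1 (isUnit_of_map_unit _ _ hu')
  · rw [Ideal.map_le_iff_le_comap]
    intro a ha
    rw [← I.ker_subschemeι_app, RingHom.mem_ker] at ha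
    change I.subschemeι.stalkMap z (X.presheaf.germ V _ hx a) = 0
    rw [hgerm]
    exact (congr_arg _ ha).trans (map_zero _)

end LocalRings
end SurfaceCovering

namespace SurfaceCovering

/-! ### The algebra of a cyclic covering and its local rings over the branch locus. -/

section CyclicAlgebra

variable {R R' : Type*} [CommRing R] [CommRing R']

/-- `R'` is free over `R` with basis `1, t, …, t ^ (n - 1)` and `t ^ n = s`. -/
structure IsCyclicAlgebra (ψ : R →+* R') (n : ℕ) (s : R) (t : R') : Prop where
  pow_eq : t ^ n = ψ s
  basis : ∀ a : R', ∃! c : Fin n → R, a = ∑ l : Fin n, ψ (c l) * t ^ (l : ℕ)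

namespace IsCyclicAlgebra

variable {ψ : R →+* R'} {n : ℕ} {s : R} {t : R'}

lemma exists_dvd_sub (h : IsCyclicAlgebra ψ (n + 1) s t) (r : R') : ∃ a, t ∣ r - ψ a := by
  obtain ⟨c, hc, -⟩ := h.basis r
  refine ⟨c 0, ∑ l : Fin n, ψ (c l.succ) * t ^ (l : ℕ), ?_⟩
  rw [hc, Fin.sum_univ_succ, Finset.mul_sum]
  simp only [Fin.val_zero, pow_zero, mul_one, Fin.val_succ, add_sub_cancel_left]
  exact Finset.sum_congr rfl fun l _ ↦ by ring

/-- Multiplication by `t` shifts the coordinates cyclically, the last one returning with a factor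
`s`. -/
lemma mul_sum (h : IsCyclicAlgebra ψ (n + 1) s t) (c : Fin (n + 1) → R) :
    t * ∑ l, ψ (c l) * t ^ (l : ℕ) =
      ∑ l, ψ (Fin.cons (α := fun _ ↦ R) (s * c (Fin.last n)) (fun l ↦ c l.castSucc) l) *
        t ^ (l : ℕ) := by
  rw [Fin.sum_univ_castSucc, Fin.sum_univ_succ, mul_add, Finset.mul_sum]
  simp only [Fin.val_castSucc, Fin.val_last, Fin.cons_zero, Fin.cons_succ, Fin.val_zero,
    Fin.val_succ, pow_zero, mul_one, map_mul, ← h.pow_eq]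
  rw [add_comm]
  congr 1
  · ring
  · exact Finset.sum_congr rfl fun l _ ↦ by ring

lemma dvd_of_dvd_map (h : IsCyclicAlgebra ψ (n + 1) s t) {r : R} (hr : t ∣ ψ r) : s ∣ r := by
  obtain ⟨d, hd⟩ := hr
  obtain ⟨c, hc, -⟩ := h.basis d
  rw [hc, h.mul_sum] at hd
  have h1 : ψ r = ∑ l, ψ (Fin.cons (α := fun _ ↦ R) r (fun _ : Fin n ↦ 0) l) * t ^ (l : ℕ) := by
    rw [Fin.sum_univ_succ]
    simp
  have := congr_fun ((h.basis (ψ r)).unique h1 hd) 0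
  exact ⟨_, this⟩

lemma sum_eq_zero (h : IsCyclicAlgebra ψ n s t) {c : Fin n → R}
    (hc : ∑ l, ψ (c l) * t ^ (l : ℕ) = 0) : c = 0 :=
  (h.basis 0).unique hc.symm (by simp)

variable [IsDomain R]

lemma mem_nonZeroDivisors (h : IsCyclicAlgebra ψ (n + 1) s t) (hs : s ≠ 0) :
    t ∈ nonZeroDivisors R' := by
  rw [mem_nonZeroDivisors_iff_right]
  intro x hx
  obtain ⟨c, rfl, -⟩ := h.basis x
  rw [mul_comm, h.mul_sum] at hx
  have h0 := h.sum_eq_zero hx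
  have : ∀ l, c l = 0 := by
    intro l
    induction l using Fin.lastCases with
    | last => exact (mul_eq_zero.1 (congr_fun h0 0)).resolve_left hs
    | cast l => exact congr_fun h0 l.succ
  simp [this]

lemma map_mem_nonZeroDivisors (h : IsCyclicAlgebra ψ n s t) {a : R} (ha : a ≠ 0) :
    ψ a ∈ nonZeroDivisors R' := by
  rw [mem_nonZeroDivisors_iff_right]
  intro x hx
  obtain ⟨c, rfl, -⟩ := h.basis x
  rw [Finset.sum_mul] at hx
  have h0 := h.sum_eq_zero (c := fun l ↦ a * c l) (by
    rw [← hx]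
    exact Finset.sum_congr rfl fun l _ ↦ by rw [map_mul]; ring)
  have : ∀ l, c l = 0 := fun l ↦ (mul_eq_zero.1 (congr_fun h0 l)).resolve_left ha
  simp [this]

/-- In the local ring of a cyclic covering at a ramification point, the root `t` of the branch
equation and a transversal parameter of the base form a pair of parameters. -/
lemma isParameterPair (h : IsCyclicAlgebra ψ (n + 1) s t) {A O : Type*} [CommRing A] [CommRing O]
    [IsLocalRing A] [IsLocalRing O] [Algebra R A] [Algebra R' O] (p : Ideal R) [p.IsPrime]
    (q : Ideal R') [q.IsPrime] [IsLocalization.AtPrime A p] [IsLocalization.AtPrime O q]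
    (φ : A →+* O) [IsLocalHom φ] (hφ : ∀ r, φ (algebraMap R A r) = algebraMap R' O (ψ r)) {y : A}
    (hy : IsParameterPair (algebraMap R A s) y) : IsParameterPair (algebraMap R' O t) (φ y) := by
  have hs0 : s ≠ 0 := by
    rintro rfl
    have := hy.left_mem
    rw [map_zero] at this
    exact zero_notMem_nonZeroDivisors this
  have hpow : algebraMap R' O t ^ (n + 1) = φ (algebraMap R A s) := by
    rw [← map_pow, h.pow_eq, hφ]
  have htm : algebraMap R' O t ∈ IsLocalRing.maximalIdeal O := by
    refine (IsLocalRing.maximalIdeal.isMaximal O).isPrime.mem_of_pow_mem (n + 1) ?_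
    rw [hpow]
    exact map_nonunit φ _ hy.left_mem_maximalIdeal
  have htq : t ∈ q := by
    rw [← IsLocalization.AtPrime.under_maximalIdeal O q]
    exact htm
  have hunit {σ : R} (hσ : ψ σ ∉ q) : IsUnit (algebraMap R A σ) := by
    refine isUnit_of_map_unit φ _ ?_
    rw [hφ]
    exact IsLocalization.map_units O (⟨ψ σ, hσ⟩ : q.primeCompl)
  have hlift {σ' : R'} (hσ' : σ' ∉ q) : ∃ σ, t ∣ σ' - ψ σ ∧ ψ σ ∉ q := by
    obtain ⟨σ, hσ⟩ := h.exists_dvd_sub σ'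
    refine ⟨σ, hσ, fun hq ↦ hσ' ?_⟩
    have := add_mem (Ideal.mem_of_dvd q hσ htq) hq
    simpa using this
  -- Together with `hker` this identifies `O / t` with `A / s`. Since `t` lies in `q`, denominators
  -- from `R'` may be replaced modulo `t` by elements of `R`, which are already units in `A`.
  have hsurj (x : O) : ∃ a : A, algebraMap R' O t ∣ x - φ a := by
    obtain ⟨r', σ', rfl⟩ := IsLocalization.exists_mk'_eq q.primeCompl x
    obtain ⟨r, u, hu⟩ := h.exists_dvd_sub r'
    obtain ⟨σ, ⟨v, hv⟩, hσq⟩ := hlift σ'.2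
    obtain ⟨w, hw⟩ := (hunit hσq).exists_right_inv
    refine ⟨algebraMap R A r * w, ?_⟩
    have hw' : algebraMap R' O (ψ σ) * φ w = 1 := by
      rw [← hφ, ← map_mul, hw, map_one]
    have hspec := IsLocalization.mk'_spec O r' σ'
    set x := IsLocalization.mk' O r' σ'
    have hu' := congr_arg (algebraMap R' O) hu
    have hv' := congr_arg (algebraMap R' O) hv
    rw [map_sub, map_mul] at hu' hv'
    rw [map_mul, hφ]
    refine ⟨φ w * (algebraMap R' O u - x * algebraMap R' O v), ?_⟩
    linear_combination (-x) * hw' + φ w * hu' - x * φ w * hv' + φ w * hspec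
  have hker (a : A) (ha : algebraMap R' O t ∣ φ a) : algebraMap R A s ∣ a := by
    obtain ⟨r, σ, rfl⟩ := IsLocalization.exists_mk'_eq p.primeCompl a
    have h1 : algebraMap R' O t ∣ algebraMap R' O (ψ r) := by
      rw [← hφ, ← IsLocalization.mk'_spec A r σ, map_mul]
      exact dvd_mul_of_dvd_left ha _
    have h2 := IsLocalization.mk'_mem_map_algebraMap_iff q.primeCompl O (Ideal.span {t}) (ψ r) 1
    rw [IsLocalization.mk'_one, Ideal.map_span, Set.image_singleton,
      Ideal.mem_span_singleton] at h2
    obtain ⟨ρ, hρ, hd⟩ := h2.1 h1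
    obtain ⟨ρ₀, hρ₀, hρ₀q⟩ := hlift hρ
    have h3 : t ∣ ψ (ρ₀ * r) := by
      have := dvd_sub (Ideal.mem_span_singleton.1 hd) (dvd_mul_of_dvd_left hρ₀ (ψ r))
      rw [map_mul]
      convert this using 1
      ring
    have h4 := map_dvd (algebraMap R A) (h.dvd_of_dvd_map h3)
    rw [map_mul, (hunit hρ₀q).dvd_mul_left, ← IsLocalization.mk'_spec A r σ,
      (IsLocalization.map_units A σ).dvd_mul_right] at h4
    exact h4
  refine ⟨?_, ?_, ?_, ?_⟩
  · apply le_antisymm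
    · intro x hx
      obtain ⟨a, d, hd⟩ := hsurj x
      have ha : a ∈ IsLocalRing.maximalIdeal A := by
        rw [IsLocalRing.mem_maximalIdeal, mem_nonunits_iff, ← isUnit_map_iff φ,
          ← mem_nonunits_iff, ← IsLocalRing.mem_maximalIdeal]
        have := sub_mem hx (Ideal.mul_mem_right d _ htm)
        rw [← hd] at this
        simpa using this
      rw [hy.span_eq] at ha
      obtain ⟨b, c, rfl⟩ := Ideal.mem_span_pair.1 ha
      refine Ideal.mem_span_pair.2 ⟨d + φ b * algebraMap R' O t ^ n, φ c, ?_⟩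
      rw [map_add, map_mul, map_mul, ← hpow] at hd
      linear_combination -hd
    · rw [Ideal.span_le]
      rintro z (rfl | rfl)
      · exact htm
      · exact map_nonunit φ _ hy.right_mem_maximalIdeal
  · exact IsLocalization.map_nonZeroDivisors_le q.primeCompl O
      (Submonoid.mem_map_of_mem _ (h.mem_nonZeroDivisors hs0))
  · obtain ⟨a, σ, rfl⟩ := IsLocalization.exists_mk'_eq p.primeCompl y
    have ha : a ≠ 0 := by
      rintro rfl
      have := hy.right_mem
      rw [IsLocalization.mk'_zero] at this
      exact zero_notMem_nonZeroDivisors this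
    have h1 : algebraMap R' O (ψ a) ∈ nonZeroDivisors O :=
      IsLocalization.map_nonZeroDivisors_le q.primeCompl O
        (Submonoid.mem_map_of_mem _ (h.map_mem_nonZeroDivisors ha))
    rw [← hφ, ← IsLocalization.mk'_spec A a σ, map_mul, mul_mem_nonZeroDivisors] at h1
    exact h1.1
  · rintro x ⟨d, hd⟩
    obtain ⟨a, e, he⟩ := hsurj x
    obtain ⟨b, rfl⟩ := hy.dvd a (hker _ ⟨d - φ y * e, by
      rw [map_mul]; linear_combination hd - φ y * he⟩)
    rw [map_mul, ← hpow] at he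
    exact ⟨e + algebraMap R' O t ^ n * φ b, by linear_combination he⟩

end IsCyclicAlgebra

end CyclicAlgebra
end SurfaceCovering

namespace SurfaceCovering

/-! ### Parameters along a smooth divisor, and maps from spectra of local rings. -/

section Geometry

variable {X Y : Scheme.{u}}

lemma IsEffectiveDivisor.exists_stalkIdeal_eq {I : X.IdealSheafData} (hI : IsEffectiveDivisor I)
    (x : X) : ∃ e ∈ nonZeroDivisors (X.presheaf.stalk x), stalkIdeal I x = Ideal.span {e} := by
  obtain ⟨V, hx, f, hf, he⟩ := hI x
  have hloc := V.2.isLocalization_stalk ⟨x, hx⟩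
  let := TopCat.Presheaf.algebra_section_stalk X.presheaf ⟨x, hx⟩
  refine ⟨algebraMap Γ(X, V.1) (X.presheaf.stalk x) f,
    IsLocalization.map_nonZeroDivisors_le
      (V.2.primeIdealOf ⟨x, hx⟩).asIdeal.primeCompl _ (Submonoid.mem_map_of_mem _ hf), ?_⟩
  rw [stalkIdeal_eq I x V hx, he, Ideal.map_span, Set.image_singleton]
  rfl

lemma mem_nonZeroDivisors_of_span_eq {A : Type*} [CommRing A] {e s : A}
    (he : e ∈ nonZeroDivisors A) (h : Ideal.span {e} = Ideal.span {s}) : s ∈ nonZeroDivisors A := by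
  obtain ⟨c, rfl⟩ := Ideal.span_singleton_le_span_singleton.1 h.le
  exact (mul_mem_nonZeroDivisors.1 he).1

/-- The local ring of the curve B at Q is the quotient by `s`. Any lift `y` of its uniformizer
completes `s` to a pair: it is regular modulo `s`, and nonzero in a domain. -/
lemma exists_isParameterPair_of_isSmoothDivisor {k : Type u} [Field k]
    {f : Y ⟶ Spec (CommRingCat.of k)} (hY : IsSmoothSurface f) {B : Y.IdealSheafData}
    (hB : IsSmoothDivisor f B) {Q : Y} (hQ : IsClosed ({Q} : Set Y)) (hQB : Q ∈ B.support)
    {s : Y.presheaf.stalk Q} (hs : stalkIdeal B Q = Ideal.span {s}) :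
    ∃ y, IsParameterPair s y := by
  have := hY.integral
  obtain ⟨z, rfl⟩ : ∃ z : B.subscheme, B.subschemeι z = Q := by
    rw [← SetLike.mem_coe, ← B.range_subschemeι] at hQB
    exact hQB
  have hz : IsClosed ({z} : Set B.subscheme) := by
    convert hQ.preimage B.subschemeι.continuous
    ext w
    exact (B.subschemeι.isEmbedding.injective.eq_iff).symm
  have := hB.2
  obtain ⟨w, hw, hmax⟩ := hasUniformizer_stalk_of_smooth (B.subschemeι ≫ f) z hz
  obtain ⟨y, rfl⟩ := B.subschemeι.stalkMap_surjective z w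
  have hker (a : Y.presheaf.stalk (B.subschemeι z)) :
      (B.subschemeι.stalkMap z).hom a = 0 ↔ s ∣ a := by
    rw [← RingHom.mem_ker, ker_stalkMap_subschemeι, hs, Ideal.mem_span_singleton]
  obtain ⟨e, he, hes⟩ := hB.1.exists_stalkIdeal_eq (B.subschemeι z)
  have hmem (a : Y.presheaf.stalk (B.subschemeι z)) :
      (B.subschemeι.stalkMap z).hom a ∈ IsLocalRing.maximalIdeal _ ↔
        a ∈ IsLocalRing.maximalIdeal _ := by
    rw [IsLocalRing.mem_maximalIdeal, IsLocalRing.mem_maximalIdeal, mem_nonunits_iff,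
      mem_nonunits_iff, isUnit_map_iff]
  have hym : y ∈ IsLocalRing.maximalIdeal _ := by
    rw [← hmem, hmax]
    exact Ideal.mem_span_singleton_self _
  refine ⟨y, ?_, mem_nonZeroDivisors_of_span_eq he (hes.symm.trans hs), ?_, ?_⟩
  · apply le_antisymm
    · intro x hx
      rw [← hmem, hmax] at hx
      obtain ⟨c, hc⟩ := Ideal.mem_span_singleton'.1 hx
      obtain ⟨c, rfl⟩ := B.subschemeι.stalkMap_surjective z c
      have : (B.subschemeι.stalkMap z).hom (x - c * y) = 0 := by
        rw [map_sub, map_mul, sub_eq_zero]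
        exact hc.symm
      obtain ⟨d, hd⟩ := (hker _).1 this
      exact Ideal.mem_span_pair.2 ⟨d, c, by linear_combination -hd⟩
    · rw [Ideal.span_le]
      rintro x (rfl | rfl)
      · rw [SetLike.mem_coe, ← hmem, (hker x).2 dvd_rfl]
        exact zero_mem _
      · exact hym
  · refine mem_nonZeroDivisors_of_ne_zero ?_
    rintro rfl
    have : (B.subschemeι.stalkMap z) 0 = 0 := map_zero (B.subschemeι.stalkMap z).hom
    rw [this] at hw
    exact zero_notMem_nonZeroDivisors hw
  · intro a ha
    rw [← hker, map_mul] at ha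
    rw [← hker]
    rw [mul_comm] at ha
    exact mem_nonZeroDivisors_iff_right.1 hw _ ha

lemma ideal_comap_fromSpecStalk_top (I : Y.IdealSheafData) (x : Y) :
    (I.comap (Y.fromSpecStalk x)).ideal ⟨⊤, isAffineOpen_top _⟩ =
      (stalkIdeal I x).map (Scheme.ΓSpecIso (Y.presheaf.stalk x)).inv.hom := by
  obtain ⟨_, ⟨U, hU, rfl⟩, hx, -⟩ := Y.isBasis_affineOpens.exists_subset_of_mem_open
    (Set.mem_univ x) isOpen_univ
  have hle : (⊤ : (Spec (Y.presheaf.stalk x)).Opens) ≤ Y.fromSpecStalk x ⁻¹ᵁ U := by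
    intro p _
    have := ((IsLocalRing.specializes_closedPoint p).map (Y.fromSpecStalk x).continuous)
    rw [Scheme.fromSpecStalk_closedPoint] at this
    exact this.mem_open U.2 hx
  rw [ideal_comap I _ ⟨U, hU⟩ ⟨⊤, isAffineOpen_top _⟩ hle, stalkIdeal_eq I x ⟨U, hU⟩ hx,
    Ideal.map_map, ← CommRingCat.hom_comp, Scheme.Hom.appLE, Scheme.fromSpecStalk_app hx,
    Category.assoc, Category.assoc, ← Functor.map_comp]
  congr 3

/-- Makes the universal property of a blow-up applicable to spectra of algebras over the local ring
of the centre. -/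
lemma isEffectiveDivisor_comap_spec (J : Y.IdealSheafData) (x : Y) {A : CommRingCat.{u}}
    (ι : Y.presheaf.stalk x ⟶ A) {e : A} (he : e ∈ nonZeroDivisors A)
    (h : (stalkIdeal J x).map ι.hom = Ideal.span {e}) :
    IsEffectiveDivisor (J.comap (Spec.map ι ≫ Y.fromSpecStalk x)) := by
  intro p
  refine ⟨⟨⊤, isAffineOpen_top _⟩, trivial, (Scheme.ΓSpecIso A).inv e, ?_, ?_⟩
  · rw [mem_nonZeroDivisors_iff_right] at he ⊢
    intro z hz
    let E := (Scheme.ΓSpecIso A).commRingCatIsoToRingEquiv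
    have h0 : E z * e = 0 := by
      have := congr_arg E hz
      rw [map_mul, map_zero] at this
      rwa [show E ((Scheme.ΓSpecIso A).inv e) = e from E.apply_symm_apply e] at this
    exact (map_eq_zero_iff E E.injective).1 (he _ h0)
  · rw [Scheme.IdealSheafData.comap_comp, ideal_comap_top, ideal_comap_fromSpecStalk_top,
      Ideal.map_map, ← CommRingCat.hom_comp, ← Scheme.ΓSpecIso_inv_naturality,
      CommRingCat.hom_comp, ← Ideal.map_map, h, Ideal.map_span, Set.image_singleton]

lemma exists_eq_specMap_fromSpecStalk {A : CommRingCat.{u}} [IsLocalRing A] (l : Spec A ⟶ Y) {x : Y}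
    (h : l (IsLocalRing.closedPoint A) = x) :
    ∃ ψ : Y.presheaf.stalk x ⟶ A, l = Spec.map ψ ≫ Y.fromSpecStalk x := by
  subst h
  exact ⟨_, (Scheme.Spec_stalkClosedPointTo_fromSpecStalk l).symm⟩

lemma IsParameterPair.of_equiv {A A' : Type*} [CommRing A] [CommRing A'] [IsLocalRing A]
    [IsLocalRing A'] (e : A ≃+* A') {s y : A} (h : IsParameterPair s y) :
    IsParameterPair (e s) (e y) where
  span_eq := by
    have := IsLocalRing.map_maximalIdeal_of_surjective (e : A →+* A') e.surjective
    rw [← this, h.span_eq, Ideal.map_span, Set.image_pair]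
    rfl
  left_mem := by
    have := h.left_mem
    rw [mem_nonZeroDivisors_iff_right] at this ⊢
    intro x hx
    exact (map_eq_zero_iff e.symm e.symm.injective).1 (this _ (by
      apply e.injective; rw [map_mul, e.apply_symm_apply, hx, map_zero]))
  right_mem := by
    have := h.right_mem
    rw [mem_nonZeroDivisors_iff_right] at this ⊢
    intro x hx
    exact (map_eq_zero_iff e.symm e.symm.injective).1 (this _ (by
      apply e.injective; rw [map_mul, e.apply_symm_apply, hx, map_zero]))
  dvd a ha := by
    have := map_dvd e.symm ha
    rw [map_mul, e.symm_apply_apply, e.symm_apply_apply] at this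
    have := map_dvd e (h.dvd _ this)
    rwa [e.apply_symm_apply] at this

end Geometry
end SurfaceCovering

namespace SurfaceCovering

/-! ### The local ring of the blow-up at a point of the strict transform. -/

section BlowUp

variable {Y Y' : Scheme.{u}}

lemma stalkIdeal_exceptional (b : Y' ⟶ Y) (q : Y') (hQ : IsClosed ({b q} : Set Y))
    {s y : Y.presheaf.stalk (b q)} (h : IsParameterPair s y) :
    stalkIdeal (exceptional b (b q)) q =
      Ideal.span {(b.stalkMap q).hom s, (b.stalkMap q).hom y} := by
  rw [exceptional, stalkIdeal_comap, stalkIdeal_pointIdeal _ hQ, h.span_eq, Ideal.map_span,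
    Set.image_pair]

lemma mem_stalkIdeal_strictTransform (b : Y' ⟶ Y) (q : Y')
    (hE : IsEffectiveDivisor (exceptional b (b q))) (I : Y.IdealSheafData)
    {ε : Y'.presheaf.stalk q} (hε : stalkIdeal (exceptional b (b q)) q = Ideal.span {ε})
    (g : Y'.presheaf.stalk q) :
    g ∈ stalkIdeal (strictTransform b (b q) I) q ↔
      ∃ N : ℕ, ε ^ N * g ∈ (stalkIdeal I (b q)).map (b.stalkMap q).hom := by
  rw [← stalkIdeal_comap]
  exact mem_stalkIdeal_ker_complement _ _ hE q hε g

/-- At a point of the strict transform of the curve `s = 0`, the exceptional divisor is defined by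
the transversal parameter `y`. -/
lemma exists_eq_mul_of_mem_strictTransform (b : Y' ⟶ Y) (q : Y') (hQ : IsClosed ({b q} : Set Y))
    (hE : IsEffectiveDivisor (exceptional b (b q))) {B : Y.IdealSheafData}
    {s y : Y.presheaf.stalk (b q)} (h : IsParameterPair s y)
    (hB : stalkIdeal B (b q) = Ideal.span {s})
    (hq : q ∈ (strictTransform b (b q) B).support) :
    ∃ x ∈ IsLocalRing.maximalIdeal (Y'.presheaf.stalk q),
      (b.stalkMap q).hom s = (b.stalkMap q).hom y * x ∧
      stalkIdeal (exceptional b (b q)) q = Ideal.span {(b.stalkMap q).hom y} ∧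
      (b.stalkMap q).hom y ∈ nonZeroDivisors (Y'.presheaf.stalk q) := by
  have hexc := stalkIdeal_exceptional b q hQ h
  obtain ⟨e, he, hexc'⟩ := hE.exists_stalkIdeal_eq q
  set φ := (b.stalkMap q).hom
  -- Otherwise `1` lies in the saturation of `(φ s)` by `e`, and `q` is off the strict transform.
  have hnot : ¬ φ s ∣ e := by
    intro hdvd
    rw [mem_support_iff_stalkIdeal] at hq
    refine hq ((Ideal.eq_top_iff_one _).2 ?_)
    rw [mem_stalkIdeal_strictTransform b q hE B hexc', hB, Ideal.map_span, Set.image_singleton]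
    exact ⟨1, Ideal.mem_span_singleton.2 (by simpa using hdvd)⟩
  have hspan := hexc'.symm.trans hexc
  obtain ⟨a, ha⟩ : e ∣ φ s := Ideal.mem_span_singleton.1 (by
    rw [hspan]; exact Ideal.subset_span (by simp))
  obtain ⟨c, hc⟩ : e ∣ φ y := Ideal.mem_span_singleton.1 (by
    rw [hspan]; exact Ideal.subset_span (by simp))
  obtain ⟨α, β, hαβ⟩ := Ideal.mem_span_pair.1
    (show e ∈ Ideal.span {φ s, φ y} from hspan ▸ Ideal.mem_span_singleton_self e)
  -- One of `a`, `c` must be a unit; it is not `a`, since then `φ s` would divide `e`. So `φ y`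
  -- generates the exceptional ideal.
  have hone : α * a + β * c = 1 := by
    refine (mul_cancel_left_mem_nonZeroDivisors he).1 ?_
    rw [ha, hc] at hαβ
    linear_combination hαβ
  have ha' : a ∈ IsLocalRing.maximalIdeal (Y'.presheaf.stalk q) := by
    intro hu
    obtain ⟨v, hv⟩ := hu.exists_right_inv
    exact hnot ⟨v, by rw [ha, mul_assoc, hv, mul_one]⟩
  have hcu : IsUnit c := by
    by_contra hcu
    have := add_mem (Ideal.mul_mem_left _ α ha')
      (Ideal.mul_mem_left _ β ((IsLocalRing.mem_maximalIdeal c).2 hcu))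
    rw [hone] at this
    exact (IsLocalRing.mem_maximalIdeal _).1 this isUnit_one
  obtain ⟨v, hv⟩ := hcu.exists_right_inv
  refine ⟨v * a, Ideal.mul_mem_left _ _ ha', ?_, ?_, ?_⟩
  · rw [ha, hc]
    linear_combination (-e * a) * hv
  · rw [hexc', hc, Ideal.span_singleton_mul_right_unit hcu]
  · rw [hc]
    exact mul_mem he hcu.mem_nonZeroDivisors

/-- Given a local homomorphism `φ` that makes `s` a multiple of `y`, the corresponding local ring
of the chart `A[s / y]`. -/
lemma BlowUpChart.exists_localRing {A O : Type u} [CommRing A] [CommRing O] [IsLocalRing A]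
    [IsLocalRing O] (φ : A →+* O) [IsLocalHom φ] {s y : A} (h : IsParameterPair s y) {x : O}
    (hx : x ∈ IsLocalRing.maximalIdeal O) (hs : φ s = φ y * x) :
    ∃ (R : Type u) (_ : CommRing R) (_ : IsLocalRing R) (ι : A →+* R) (θ : R →+* O) (z : R),
      IsParameterPair z (ι y) ∧ IsLocalHom θ ∧ θ.comp ι = φ ∧ ι s = ι y * z ∧ θ z = x ∧
        ∀ f : R →+* R, f.comp ι = ι → f = RingHom.id R := by
  let κ : BlowUpChart s y →+* O := BlowUpChart.lift φ x hs.symm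
  let q : Ideal (BlowUpChart s y) := (IsLocalRing.maximalIdeal O).comap κ
  let α : BlowUpChart s y →+* Localization.AtPrime q := algebraMap _ _
  let ι : A →+* Localization.AtPrime q := α.comp (algebraMap A (BlowUpChart s y))
  have hpair : IsParameterPair (α (BlowUpChart.x s y)) (ι y) := by
    refine BlowUpChart.isParameterPair_localization h q ?_ ?_ _
    · change κ _ ∈ IsLocalRing.maximalIdeal O
      rwa [BlowUpChart.lift_x]
    · ext a
      change κ (algebraMap _ _ a) ∈ IsLocalRing.maximalIdeal O ↔ _
      rw [BlowUpChart.lift_algebraMap, IsLocalRing.mem_maximalIdeal, IsLocalRing.mem_maximalIdeal,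
        mem_nonunits_iff, mem_nonunits_iff, isUnit_map_iff]
  have hκ (t : q.primeCompl) : IsUnit (κ t) := not_not.1 fun ht ↦ t.2 ht
  have hs' : ι s = ι y * α (BlowUpChart.x s y) := by
    refine Eq.trans ?_ (map_mul α _ _)
    exact congr_arg α (BlowUpChart.algebraMap_mul_x s y).symm
  refine ⟨Localization.AtPrime q, inferInstance, inferInstance, ι, IsLocalization.lift hκ,
    α (BlowUpChart.x s y), hpair, ⟨fun r hr ↦ ?_⟩, ?_, hs', ?_, fun f hf ↦ ?_⟩
  · obtain ⟨p, t, rfl⟩ := IsLocalization.exists_mk'_eq q.primeCompl r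
    rw [IsLocalization.lift_mk'] at hr
    refine (IsLocalization.AtPrime.isUnit_mk'_iff (Localization.AtPrime q) q p t).2 ?_
    exact fun hp ↦ hp (isUnit_of_mul_isUnit_left hr)
  · ext a
    change IsLocalization.lift hκ (algebraMap (BlowUpChart s y) (Localization.AtPrime q)
      (algebraMap A (BlowUpChart s y) a)) = φ a
    rw [IsLocalization.lift_eq]
    exact BlowUpChart.lift_algebraMap _ _ _ _
  · change IsLocalization.lift hκ (algebraMap _ _ _) = _
    rw [IsLocalization.lift_eq]
    exact BlowUpChart.lift_x _ _ _
  -- An endomorphism fixing `A` fixes `s / y`, because `y` is regular in the localization. This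
  -- rigidity makes the comparison with the blow-up an isomorphism.
  · have hι (a) : f (ι a) = ι a := congr_arg (fun g ↦ g a) hf
    have hfx : f (α (BlowUpChart.x s y)) = α (BlowUpChart.x s y) := by
      refine (mul_cancel_left_mem_nonZeroDivisors hpair.right_mem).1 ?_
      rw [← hs']
      conv_lhs => rw [← hι y]
      rw [← map_mul, ← hs', hι]
    have : f.comp α = α := BlowUpChart.ext_of_algebraMap hι hfx
    exact IsLocalization.ringHom_ext q.primeCompl this

/-- The local ring of a blow-up of a point at a point of the exceptional divisor in the chart where
`y` generates it is a local ring of `A[s / y]`. -/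
lemma IsBlowUp.isParameterPair {b : Y' ⟶ Y} {q : Y'} (hb : IsBlowUp b (pointIdeal (b q)))
    (hQ : IsClosed ({b q} : Set Y)) {s y : Y.presheaf.stalk (b q)} (h : IsParameterPair s y)
    {x : Y'.presheaf.stalk q} (hx : x ∈ IsLocalRing.maximalIdeal (Y'.presheaf.stalk q))
    (hs : (b.stalkMap q).hom s = (b.stalkMap q).hom y * x)
    (hexc : stalkIdeal (exceptional b (b q)) q = Ideal.span {(b.stalkMap q).hom y})
    (hy : (b.stalkMap q).hom y ∈ nonZeroDivisors (Y'.presheaf.stalk q)) :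
    IsParameterPair x ((b.stalkMap q).hom y) := by
  obtain ⟨R, _, _, ι₀, θ₀, z, hpair, hloc, hιθ₀, hιs, hz, hid⟩ :=
    BlowUpChart.exists_localRing (b.stalkMap q).hom h hx hs
  let ι : Y.presheaf.stalk (b q) ⟶ CommRingCat.of R := CommRingCat.ofHom ι₀
  let θ : CommRingCat.of R ⟶ Y'.presheaf.stalk q := CommRingCat.ofHom θ₀
  have : IsLocalRing (CommRingCat.of R) := inferInstanceAs (IsLocalRing R)
  have : IsLocalHom θ.hom := hloc
  have hιθ : ι ≫ θ = b.stalkMap q := CommRingCat.hom_ext hιθ₀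
  have hmax : (stalkIdeal (pointIdeal (b q)) (b q)).map ι.hom = Ideal.span {ι₀ y} := by
    rw [stalkIdeal_pointIdeal _ hQ, h.span_eq, Ideal.map_span, Set.image_pair]
    apply le_antisymm
    · rw [Ideal.span_le]
      rintro w (rfl | rfl)
      · exact Ideal.mem_span_singleton.2 ⟨_, hιs⟩
      · exact Ideal.mem_span_singleton_self _
    · exact Ideal.span_mono (by rintro w rfl; exact Or.inr rfl)
  -- The maximal ideal becomes principal in `R`, so its spectrum maps to the blow-up. Since `θ` is
  -- local, `l` sends the closed point to `q` and induces `ψ`, which is inverse to `θ`: one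
  -- composite by uniqueness of lifts, the other by `hid`.
  obtain ⟨l, hl, -⟩ := hb.2 _ (Spec.map ι ≫ Y.fromSpecStalk (b q))
    (isEffectiveDivisor_comap_spec _ _ ι hpair.right_mem hmax)
  have heff : IsEffectiveDivisor
      ((pointIdeal (b q)).comap (Spec.map (b.stalkMap q) ≫ Y.fromSpecStalk (b q))) := by
    refine isEffectiveDivisor_comap_spec _ _ _ hy ?_
    rw [← hexc, exceptional, stalkIdeal_comap]
  have hθl : Spec.map θ ≫ l = Y'.fromSpecStalk q := by
    refine (hb.2 _ _ heff).unique ?_ ?_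
    · rw [Category.assoc, hl, ← Spec.map_comp_assoc, hιθ]
    · exact (Scheme.SpecMap_stalkMap_fromSpecStalk b).symm
  have hclosed : l (IsLocalRing.closedPoint (CommRingCat.of R)) = q := by
    have h1 := congr_arg (fun g : Spec (Y'.presheaf.stalk q) ⟶ Y' ↦
      g (IsLocalRing.closedPoint (Y'.presheaf.stalk q))) hθl
    have h2 : Spec.map θ (IsLocalRing.closedPoint (Y'.presheaf.stalk q)) =
        IsLocalRing.closedPoint (CommRingCat.of R) := Spec_closedPoint
    rw [← h2]
    exact h1.trans Scheme.fromSpecStalk_closedPoint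
  obtain ⟨ψ, hψ⟩ := exists_eq_specMap_fromSpecStalk l hclosed
  have hψθ : ψ ≫ θ = 𝟙 _ := by
    apply Spec.map_injective
    rw [← cancel_mono (Y'.fromSpecStalk q), Spec.map_comp, Category.assoc, ← hψ, hθl, Spec.map_id,
      Category.id_comp]
  have hbψ : b.stalkMap q ≫ ψ = ι := by
    apply Spec.map_injective
    rw [← cancel_mono (Y.fromSpecStalk (b q)), Spec.map_comp, Category.assoc,
      Scheme.SpecMap_stalkMap_fromSpecStalk, ← Category.assoc, ← hψ, hl]
  have hθψ : ψ.hom.comp θ₀ = RingHom.id R := by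
    refine hid _ ?_
    rw [RingHom.comp_assoc, hιθ₀]
    exact congr_arg (fun f ↦ f.hom) hbψ
  have hE := hpair.of_equiv (RingEquiv.ofRingHom θ₀ ψ.hom (congr_arg (fun f ↦ f.hom) hψθ) hθψ)
  change IsParameterPair (θ₀ z) (θ₀ (ι₀ y)) at hE
  rw [hz] at hE
  rwa [show θ₀ (ι₀ y) = (b.stalkMap q).hom y from congr_arg (fun f ↦ f y) hιθ₀] at hE

end BlowUp
end SurfaceCovering

/-! ### Weighted multiplicity on the covering and along the cluster. -/

namespace SurfaceCovering

/-- Near `Q` the curve `B` is part of a parameter pair, and the local equation of `C` has weighted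
order exactly `m` when the equation of `B` has weight `n` and the transversal parameter weight
`1`. -/
def HasWeightedMultiplicity {Y : Scheme.{u}} (B C : Y.IdealSheafData) (Q : Y) (n m : ℕ) : Prop :=
  ∃ s y f : Y.presheaf.stalk Q, IsParameterPair s y ∧ stalkIdeal B Q = Ideal.span {s} ∧
    stalkIdeal C Q = Ideal.span {f} ∧ f ∈ weightedIdeal s y n m ∧ f ∉ weightedIdeal s y n (m + 1)

lemma hasMultiplicity_iff {Y : Scheme.{u}} {C : Y.IdealSheafData} {Q : Y}
    {f : Y.presheaf.stalk Q} (hf : stalkIdeal C Q = Ideal.span {f}) (m : ℕ) :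
    HasMultiplicity C Q m ↔ f ∈ IsLocalRing.maximalIdeal (Y.presheaf.stalk Q) ^ m ∧
      f ∉ IsLocalRing.maximalIdeal (Y.presheaf.stalk Q) ^ (m + 1) := by
  rw [HasMultiplicity, hf, Ideal.span_singleton_le_iff_mem, Ideal.span_singleton_le_iff_mem]

lemma HasWeightedMultiplicity.hasMultiplicity {Y : Scheme.{u}} {B C : Y.IdealSheafData} {Q : Y}
    {m : ℕ} (h : HasWeightedMultiplicity B C Q 1 m) : HasMultiplicity C Q m := by
  obtain ⟨s, y, f, hp, -, hC, hf, hf'⟩ := h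
  rw [hp.weightedIdeal_one] at hf hf'
  exact (hasMultiplicity_iff hC m).2 ⟨hf, hf'⟩

/-- If `y ^ (j + 1) * h = g * d`, then `y` divides `d` because `g` is prime to `y`, and one factor
`y` cancels. -/
lemma dvd_of_mul_dvd_pow_mul {O : Type*} [CommRing O] {y g : O} (hy : y ∈ nonZeroDivisors O)
    (hg : ∀ x, y ∣ g * x → y ∣ x) (j : ℕ) {h : O} (hd : g ∣ y ^ j * h) : g ∣ h := by
  induction j with
  | zero => simpa using hd
  | succ j ih =>
    obtain ⟨d, hd⟩ := hd
    obtain ⟨e, rfl⟩ := hg d ⟨y ^ j * h, by rw [← hd]; ring⟩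
    refine ih ⟨e, (mul_cancel_left_mem_nonZeroDivisors hy).1 ?_⟩
    linear_combination hd

lemma map_of_mem_support_exceptional {Y Y' : Scheme.{u}} (b : Y' ⟶ Y) {Q : Y}
    (hQ : IsClosed ({Q} : Set Y)) {q : Y'} (hq : q ∈ (exceptional b Q).support) : b q = Q := by
  rw [exceptional, Scheme.IdealSheafData.support_comap] at hq
  have : b q ∈ ((pointIdeal Q).support : Set Y) := hq
  rw [pointIdeal, Scheme.IdealSheafData.coe_support_vanishingIdeal] at this
  simpa [hQ.closure_eq] using this

/-- The strict transform of `φ s = y ^ μ * g`, with `g` prime to the exceptional divisor `y`, is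
`g`. -/
lemma stalkIdeal_strictTransform {Y Y' : Scheme.{u}} (b : Y' ⟶ Y) (q : Y')
    (hE : IsEffectiveDivisor (exceptional b (b q))) {I : Y.IdealSheafData}
    {y g : Y'.presheaf.stalk q} (hexc : stalkIdeal (exceptional b (b q)) q = Ideal.span {y})
    (hy : y ∈ nonZeroDivisors (Y'.presheaf.stalk q)) (hg : ∀ x, y ∣ g * x → y ∣ x)
    {f : Y.presheaf.stalk (b q)} (hI : stalkIdeal I (b q) = Ideal.span {f}) {μ : ℕ}
    (hf : (b.stalkMap q).hom f = y ^ μ * g) :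
    stalkIdeal (strictTransform b (b q) I) q = Ideal.span {g} := by
  ext h
  rw [mem_stalkIdeal_strictTransform b q hE I hexc, hI, Ideal.map_span, Set.image_singleton, hf]
  simp only [Ideal.mem_span_singleton]
  constructor
  · rintro ⟨N, hN⟩
    exact dvd_of_mul_dvd_pow_mul hy hg N ((dvd_mul_left g _).trans hN)
  · intro h
    exact ⟨μ, mul_dvd_mul_left _ h⟩

/-- One step along the cluster: the weight of the branch curve falls from `n + 1` to `n`, and the
multiplicity at the centre is split off. -/
lemma HasWeightedMultiplicity.exists_strictTransform {Y Y' : Scheme.{u}} {b : Y' ⟶ Y} {Q : Y}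
    (hQ : IsClosed ({Q} : Set Y)) (hb : IsBlowUp b (pointIdeal Q)) {B C : Y.IdealSheafData}
    {n m : ℕ} (hn : 1 ≤ n) (h : HasWeightedMultiplicity B C Q (n + 1) m) {q : Y'}
    (hq : q ∈ (exceptional b Q).support) (hqB : q ∈ (strictTransform b Q B).support) :
    ∃ μ m', m = μ + m' ∧ HasMultiplicity C Q μ ∧
      HasWeightedMultiplicity (strictTransform b Q B) (strictTransform b Q C) q n m' := by
  obtain rfl := map_of_mem_support_exceptional b hQ hq
  obtain ⟨s, y, f, hp, hB, hC, hf, hf'⟩ := h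
  have hE : IsEffectiveDivisor (exceptional b (b q)) := hb.1
  obtain ⟨x, hx, hs, hexc, hy⟩ := exists_eq_mul_of_mem_strictTransform b q hQ hE hp hB hqB
  have hp' := hb.isParameterPair hQ hp hx hs hexc hy
  obtain ⟨μ, m', g, hm, hμ, hμ', hφ, hg, hgm, hgm'⟩ :=
    hp.exists_strictTransform hp' (b.stalkMap q).hom hs rfl hn hf hf'
  -- The curve B passes simply through the centre, so its strict transform is the case `μ = 1`, with
  -- equation `x`.
  exact ⟨μ, m', hm, (hasMultiplicity_iff hC μ).2 ⟨hμ, hμ'⟩, x, (b.stalkMap q).hom y, g, hp',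
    stalkIdeal_strictTransform b q hE hexc hy (fun _ ↦ hp'.dvd_symm) hB (μ := 1) (by simpa using hs),
    stalkIdeal_strictTransform b q hE hexc hy hg hC hφ, hgm, hgm'⟩

/-- The multiplicity upstairs on a cyclic covering is a weighted multiplicity downstairs. -/
lemma HasMultiplicity.hasWeightedMultiplicity {k : Type u} [Field k] {X Y : Scheme.{u}}
    {f : Y ⟶ Spec (CommRingCat.of k)} (hY : IsSmoothSurface f) {B C : Y.IdealSheafData}
    (hB : IsSmoothDivisor f B) (hC : IsEffectiveDivisor C) {π : X ⟶ Y} {n : ℕ}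
    (hπ : IsCyclicCovering π (n + 1) B) {P : X} (hP : IsClosed ({π P} : Set Y))
    (hPR : P ∈ (ramification π B).support) {m : ℕ} (hm : HasMultiplicity (C.comap π) P m) :
    HasWeightedMultiplicity B C (π P) (n + 1) m := by
  obtain ⟨c⟩ := hπ
  have := hY.integral
  have := c.affine
  obtain ⟨i, hi⟩ := c.covers (π P)
  have : Nonempty (c.U i).1 := ⟨⟨π P, hi⟩⟩
  have hU := (c.U i).2
  have hV : IsAffineOpen (π ⁻¹ᵁ (c.U i).1) := hU.preimage π
  have hs : stalkIdeal B (π P) =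
      Ideal.span {(Y.presheaf.germ (c.U i).1 (π P) hi).hom (c.s i)} := by
    rw [stalkIdeal_eq B (π P) (c.U i) hi, c.ideal_eq, Ideal.map_span, Set.image_singleton]
  have hPB : π P ∈ B.support := by
    rw [ramification, Scheme.IdealSheafData.support_radical,
      Scheme.IdealSheafData.support_comap] at hPR
    exact hPR
  obtain ⟨y, hy⟩ := exists_isParameterPair_of_isSmoothDivisor hY hB hP hPB hs
  let _ := Y.presheaf.algebra_section_stalk ⟨π P, hi⟩
  have := hU.isLocalization_stalk ⟨π P, hi⟩
  let _ := X.presheaf.algebra_section_stalk (U := π ⁻¹ᵁ (c.U i).1) ⟨P, hi⟩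
  have := hV.isLocalization_stalk ⟨P, hi⟩
  have hcyc : IsCyclicAlgebra (π.app (c.U i).1).hom (n + 1) (c.s i) (c.t i) :=
    ⟨c.t_pow i, c.basis i⟩
  have hφ (r : Γ(Y, (c.U i).1)) : (π.stalkMap P).hom ((Y.presheaf.germ (c.U i).1 (π P) hi).hom r) =
      (X.presheaf.germ (π ⁻¹ᵁ (c.U i).1) P hi).hom ((π.app (c.U i).1).hom r) :=
    Scheme.Hom.germ_stalkMap_apply _ _ _ _ _
  have hp' := hcyc.isParameterPair (A := Y.presheaf.stalk (π P)) (O := X.presheaf.stalk P)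
    (hU.primeIdealOf ⟨π P, hi⟩).asIdeal (hV.primeIdealOf ⟨P, hi⟩).asIdeal (π.stalkMap P).hom hφ hy
  obtain ⟨e, -, he⟩ := hC.exists_stalkIdeal_eq (π P)
  have he' : stalkIdeal (C.comap π) P = Ideal.span {(π.stalkMap P).hom e} := by
    rw [stalkIdeal_comap, he, Ideal.map_span, Set.image_singleton]
  obtain ⟨h1, h2⟩ := (hasMultiplicity_iff he' m).1 hm
  have hst : (π.stalkMap P).hom ((Y.presheaf.germ (c.U i).1 (π P) hi).hom (c.s i)) =
      (X.presheaf.germ (π ⁻¹ᵁ (c.U i).1) P hi).hom (c.t i) ^ (n + 1) := by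
    rw [hφ, ← map_pow, c.t_pow]
  obtain ⟨h3, h4⟩ := hy.weightedIdeal_of_pow hp' (π.stalkMap P).hom (Nat.le_add_left 1 n) hst rfl
    h1 h2
  exact ⟨_, y, e, hy, hs, he, h3, h4⟩

/-- Along a cluster on `B`, a weighted multiplicity is the sum of the multiplicities of the strict
transforms. -/
lemma IsClusterAlong.exists_sum_eq {n : ℕ} {Y : ℕ → Scheme.{u}} {b : ∀ i, Y (i + 1) ⟶ Y i}
    {Q : ∀ i, Y i} {B : (Y 0).IdealSheafData} (h : IsClusterAlong n b Q B)
    (C : (Y 0).IdealSheafData) (j i m : ℕ) (hij : i + (j + 1) = n)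
    (hm : HasWeightedMultiplicity (iteratedStrictTransform b Q B i)
      (iteratedStrictTransform b Q C i) (Q i) (j + 1) m) :
    ∃ μ : ℕ → ℕ, (∀ l, i ≤ l → l < n →
      HasMultiplicity (iteratedStrictTransform b Q C l) (Q l) (μ l)) ∧
      m = ∑ l ∈ Finset.Ico i n, μ l := by
  -- The weight `j + 1` counts the points from `Q i` to the end. At `j = 0` the weights are (1, 1)
  -- and a single point is left.
  induction j generalizing i m with
  | zero =>
    refine ⟨fun _ ↦ m, fun l hl hln ↦ ?_, ?_⟩
    · obtain rfl : l = i := by omega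
      exact hm.hasMultiplicity
    · subst hij
      simp
  | succ j ih =>
    obtain ⟨μ₀, m', rfl, hμ, hm'⟩ := hm.exists_strictTransform (h.closed i (by omega))
      (h.blowUp i (by omega)) (by omega) (h.mem_exceptional i (by omega))
      (h.mem_branch i (by omega))
    obtain ⟨μ, hC, rfl⟩ := ih (i + 1) m' (by omega) hm'
    -- The induction hypothesis controls `μ` only from `i + 1` on, so its value at `i` is free to be
    -- set.
    refine ⟨Function.update μ i μ₀, fun l hl hln ↦ ?_, ?_⟩
    · obtain rfl | hl := hl.eq_or_lt
      · rwa [Function.update_self]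
      · rw [Function.update_of_ne (by omega)]
        exact hC l hl hln
    · rw [Finset.sum_eq_sum_Ico_succ_bot (show i < n by omega), Function.update_self]
      congr 1
      refine Finset.sum_congr rfl fun l hl ↦ ?_
      rw [Function.update_of_ne]
      rw [Finset.mem_Ico] at hl
      omega

end SurfaceCovering

theorem mainTheorem4 {k : Type u} [Field k] [IsAlgClosed k]
    (n : ℕ) (hn : (n : k) ≠ 0)
    {Y : ℕ → Scheme.{u}} (f : Y 0 ⟶ Spec (CommRingCat.of k))
    (hY : SurfaceCovering.IsSmoothSurface f)
    (B : (Y 0).IdealSheafData) (hB : SurfaceCovering.IsSmoothDivisor f B)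
    {X : Scheme.{u}} (π : X ⟶ Y 0) (hπ : SurfaceCovering.IsCyclicCovering π n B)
    (P : X) (hP : IsClosed ({P} : Set X))
    (hPR : P ∈ (SurfaceCovering.ramification π B).support)
    (b : ∀ i, Y (i + 1) ⟶ Y i) (Q : ∀ i, Y i) (hQ : Q 0 = π P)
    (hcluster : SurfaceCovering.IsClusterAlong n b Q B)
    (C : (Y 0).IdealSheafData) (hC : SurfaceCovering.IsEffectiveDivisor C)
    (m : ℕ) (hm : SurfaceCovering.HasMultiplicity (C.comap π) P m) :
    ∃ μ : Fin n → ℕ,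
      (∀ i : Fin n, SurfaceCovering.HasMultiplicity
        (SurfaceCovering.iteratedStrictTransform b Q C i) (Q i) (μ i)) ∧
      m = ∑ i, μ i := by
  obtain ⟨n, rfl⟩ : ∃ k, n = k + 1 := Nat.exists_eq_succ_of_ne_zero (by rintro rfl; simp at hn)
  have hP' : IsClosed ({π P} : Set (Y 0)) := hQ ▸ hcluster.closed 0 n.succ_pos
  have h := hm.hasWeightedMultiplicity hY hB hC hπ hP' hPR
  rw [← hQ] at h
  obtain ⟨μ, hμ, hsum⟩ := hcluster.exists_sum_eq C n 0 m (zero_add _) h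
  refine ⟨fun i ↦ μ i, fun i ↦ hμ i (Nat.zero_le _) i.2, ?_⟩
  rw [hsum, ← Finset.range_eq_Ico, Finset.sum_range]
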